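/- Write $e(x)=e^{2\pi i x}$; for real $x$ let $\delta(x)=1$ if $x\in\mathbb{Z}$ and $\delta(x)=0$ otherwise, and let $\langle x\rangle'=1-\langle -x\rangle\in(0,1]$, where $\langle x\rangle=x-\lfloor x\rfloor$. Let $\alpha,\beta,\mu,\nu$ be real and let $z=i\tau$ with $\operatorname{Im}z>0$, i.e. $|\arg\tau|<\pi/2$; put $q=e(z)=e^{-2\pi\tau}$ and $q^x=e(xz)$ for real $x$. For $\operatorname{Re}s>2$ let $$F^{\pm}(s;z)=\sum_{\substack{m,n\in\mathbb{Z}\\ \alpha+m+(\beta+n)z\neq0}}\frac{e\{(\alpha+m)\mu+(\beta+n)\nu\}}{\{\alpha+m+(\beta+n)z\}^{s}},$$ where the argument of $\alpha+m+(\beta+n)z$ is taken in $(-\pi,\pi]$ for $F^+$ and in $[-\pi,\pi)$ for $F^-$, and let $F_{\mathbb{Z}^2}(s;\alpha,\beta;\mu,\nu;z)=\frac12\{F^+(s;z)+F^-(s;z)\}$. For real $\gamma,\kappa$ let $\psi(r,\gamma,\kappa)$ be the meromorphic continuation to $\mathbb{C}$ of $\sum_{k\in\mathbb{Z},\,k>-\gamma}e\{(\gamma+k)\kappa\}(\gamma+k)^{-r}$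 $(\operatorname{Re}r>1)$, which exists, is holomorphic for $r\neq1$, and is entire if $\kappa\notin\mathbb{Z}$. For real $\gamma,\delta,\kappa,\lambda$ let $$\mathcal{S}_r(\gamma,\delta;\kappa,\lambda;q)=\sum_{\substack{k,l\in\mathbb{Z}\\ k>-\gamma,\ l>-\delta}}\frac{e\{(\gamma+k)\kappa+(\delta+l)\lambda\}}{(\delta+l)^{r}}\,q^{(\gamma+k)(\delta+l)}.$$ (i) The function $$\mathcal{A}(s,\alpha,\mu)=\cos(\pi s)\psi(s,-\alpha,-\mu)+\psi(s,\alpha,\mu)=e(\alpha\mu)\frac{(2\pi)^s}{2\Gamma(s)}\bigl\{e^{-\pi is/2}\psi(1-s,-\mu,\alpha)+e^{\pi is/2}\psi(1-s,\mu,-\alpha)\bigr\}$$ is entire in $s$; the two expressions agree with it wherever the functions $\psi$ in them have no pole (the first except possibly at $s=1$ when $\mu\in\mathbb{Z}$, the second except possibly at $s=0$ when $\alpha\in\mathbb{Z}$), with the value at an exceptional point understood as the limit. (ii) The series for $F^{\pm}$ converge absolutely for $\operatorname{Re}s>2$, the series $\mathcal{S}_{1-s}(\beta,-\mu;\nu,\alpha;q)$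 and $\mathcal{S}_{1-s}(-\beta,\mu;-\nu,-\alpha;q)$ converge absolutely for all $s\in\mathbb{C}$, and $F_{\mathbb{Z}^2}$ has a holomorphic continuation to the whole $s$-plane, given for all $s\in\mathbb{C}$ by $$F_{\mathbb{Z}^2}(s;\alpha,\beta;\mu,\nu;z)=\delta(\beta)\mathcal{A}(s,\alpha,\mu)+e(\alpha\mu)\frac{(2\pi)^s}{\Gamma(s)}\bigl\{e^{-\pi is/2}\mathcal{S}_{1-s}(\beta,-\mu;\nu,\alpha;q)+e^{\pi is/2}\mathcal{S}_{1-s}(-\beta,\mu;-\nu,-\alpha;q)\bigr\}.$$ (iii) Let $(\gamma,\delta,\kappa,\lambda)$ be $(\beta,-\mu,\nu,\alpha)$ or $(-\beta,\mu,-\nu,-\alpha)$, and $r=1-s$. Then $$\mathcal{S}_r(\gamma,\delta;\kappa,\lambda;q)=\sum_{l>-\delta}T_l,\qquad T_l=e(\langle\gamma\rangle'\kappa)\frac{e\{(\delta+l)\lambda\}\,q^{\langle\gamma\rangle'(\delta+l)}}{(\delta+l)^{r}\{1-e(\kappa)q^{\delta+l}\}},$$ and this is an asymptotic series as $\tau\to\infty$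 through any sector $|\arg\tau|\le\theta$ with $\theta<\pi/2$: $T_l\asymp\exp\{-2\pi\langle\gamma\rangle'(\delta+l)\tau\}$ for each integer $l>-\delta$, and $\mathcal{S}_r-\sum_{-\delta<l\le L}T_l=O(\exp\{-2\pi\langle\gamma\rangle'(\delta+L+1)\tau\})$ for each integer $L\ge\lfloor-\delta\rfloor$ (orders refer to absolute values). Accordingly, if the two $q$-series in the formula of (ii) are replaced by their partial sums over $\mu<l\le L$ and $-\mu<l\le L'$ respectively (with integers $L\ge\lfloor\mu\rfloor$, $L'\ge\lfloor-\mu\rfloor$), the resulting approximation to $F_{\mathbb{Z}^2}(s;\alpha,\beta;\mu,\nu;i\tau)$ has, for each fixed $s\in\mathbb{C}$, the error $O(e^{-2\pi\langle\beta\rangle'(-\mu+L+1)\operatorname{Re}\tau}+e^{-2\pi\langle-\beta\rangle'(\mu+L'+1)\operatorname{Re}\tau})$ as $\tau\to\infty$ in such a sector. -/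

import Mathlib

open Complex Filter Asymptotics

namespace HolEis

noncomputable section

/-- `e(x) = exp(2πix)`. -/
def e (x : ℂ) : ℂ := exp (2 * Real.pi * I * x)

/-- `x` is an integer. -/
def IsInt (x : ℝ) : Prop := ∃ n : ℤ, x = n

open Classical in
/-- `δ(x) = 1` if `x` is an integer and `δ(x) = 0` otherwise. -/
def delta (x : ℝ) : ℂ := if IsInt x then 1 else 0

/-- `⟨x⟩' = 1 - ⟨-x⟩`, which lies in `(0, 1]`. -/
def fracPrime (x : ℝ) : ℝ := 1 - Int.fract (-x)

/-! ### The generalized holomorphic Eisenstein series -/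

/-- The lattice point `α + m + (β + n) z`. -/
def latticePt (α β : ℝ) (z : ℂ) (p : ℤ × ℤ) : ℂ := (α + p.1) + (β + p.2) * z

/-- The argument of `w` chosen in `[-π, π)`; recall that `Complex.arg` takes values in `(-π, π]`. -/
def argMinus (w : ℂ) : ℝ := if arg w = Real.pi then -Real.pi else arg w

/-- For `w ≠ 0`, the power `w ^ s` with the argument of `w` in `(-π, π]`. -/
def powPlus (w s : ℂ) : ℂ := exp (s * (Real.log ‖w‖ + arg w * I))

/-- For `w ≠ 0`, the power `w ^ s` with the argument of `w` in `[-π, π)`. -/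
def powMinus (w s : ℂ) : ℂ := exp (s * (Real.log ‖w‖ + argMinus w * I))

/-- The summands of the Eisenstein series, with respect to a choice `pow` of the powers. -/
def eisTerm (pow : ℂ → ℂ → ℂ) (s : ℂ) (α β μ ν : ℝ) (z : ℂ) (p : ℤ × ℤ) : ℂ :=
  e ((α + p.1) * μ + (β + p.2) * ν) / pow (latticePt α β z p) s

/-- The Eisenstein series, with respect to a choice `pow` of the powers; the term (if there is one)
with `α + m + (β + n) z = 0` is omitted. -/
def eisSeries (pow : ℂ → ℂ → ℂ) (s : ℂ) (α β μ ν : ℝ) (z : ℂ) : ℂ :=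
  ∑' p : {p : ℤ × ℤ // latticePt α β z p ≠ 0}, eisTerm pow s α β μ ν z p

/-- The mean of the Eisenstein series for the two choices of the branch (for `Re s > 2`). -/
def eisF (s : ℂ) (α β μ ν : ℝ) (z : ℂ) : ℂ :=
  (eisSeries powPlus s α β μ ν z + eisSeries powMinus s α β μ ν z) / 2

/-! ### The Lerch zeta-function `ψ` -/

/-- The summands `e((γ + k) κ) / (γ + k) ^ r` of `ψ(r, γ, κ)`. -/
def psiTerm (r : ℂ) (γ κ : ℝ) (k : ℤ) : ℂ :=
  e ((γ + k) * κ) / ((γ + k : ℝ) : ℂ) ^ r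

/-- `f` is the meromorphic continuation to the plane of the function
`ψ(r, γ, κ) = ∑_{k > -γ} e((γ + k) κ) / (γ + k) ^ r` on `Re r > 1`: it is holomorphic away from
`r = 1`, and entire if `κ` is not an integer. By the identity theorem these properties determine
`f r` for all `r ≠ 1`, and for `r = 1` too if `κ` is not an integer. -/
structure IsLerchPsi (γ κ : ℝ) (f : ℂ → ℂ) : Prop where
  hasSum : ∀ r : ℂ, 1 < r.re → HasSum (fun k : {k : ℤ // -γ < k} => psiTerm r γ κ k) (f r)
  differentiableOn : DifferentiableOn ℂ f {1}ᶜ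
  meromorphicAt : MeromorphicAt f 1
  entire : ¬ IsInt κ → Differentiable ℂ f

/-- The Lerch zeta-function `ψ(r, γ, κ)`, as a meromorphic function of `r`. -/
def lerchPsi (r : ℂ) (γ κ : ℝ) : ℂ := Classical.epsilon (IsLerchPsi γ κ) r

/-- `cos(πs) ψ(s, -α, -μ) + ψ(s, α, μ)`. -/
def calA₀ (s : ℂ) (α μ : ℝ) : ℂ :=
  cos (Real.pi * s) * lerchPsi s (-α) (-μ) + lerchPsi s α μ

/-- `𝓐(s, α, μ) = cos(πs) ψ(s, -α, -μ) + ψ(s, α, μ)`, where the value at `s = 1`, at which both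
summands may have a pole, is understood as the limit. -/
def calA (s : ℂ) (α μ : ℝ) : ℂ :=
  Function.update (fun w => calA₀ w α μ) 1 (limUnder (nhdsWithin 1 {1}ᶜ) fun w => calA₀ w α μ) s

/-! ### The `q`-series -/

/-- The summands of the double series `𝓢_r(γ, δ; κ, lam; q)` with `q = e(z)`, where the power `q ^ x`
for real `x` means `e(x z)`. -/
def qTerm (r : ℂ) (γ δ κ lam : ℝ) (z : ℂ) (k l : ℤ) : ℂ :=
  e ((γ + k) * κ + (δ + l) * lam) / ((δ + l : ℝ) : ℂ) ^ r * e ((γ + k) * (δ + l) * z)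

/-- The index set `k > -γ`, `l > -δ` of the double series. -/
abbrev QIndex (γ δ : ℝ) : Type := {k : ℤ // -γ < k} × {l : ℤ // -δ < l}

/-- The `q`-series `𝓢_r(γ, δ; κ, lam; q)` with `q = e(z)`. -/
def qSeries (r : ℂ) (γ δ κ lam : ℝ) (z : ℂ) : ℂ :=
  ∑' p : QIndex γ δ, qTerm r γ δ κ lam z p.1 p.2

/-- The summands of the `q`-series after summation over `k`:
`e(⟨γ⟩' κ) e((δ + l) lam) q ^ (⟨γ⟩' (δ + l)) / ((δ + l) ^ r (1 - e(κ) q ^ (δ + l)))`. -/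
def qTermSum (r : ℂ) (γ δ κ lam : ℝ) (z : ℂ) (l : ℤ) : ℂ :=
  e (fracPrime γ * κ) * (e ((δ + l) * lam) * e (fracPrime γ * (δ + l) * z)) /
    (((δ + l : ℝ) : ℂ) ^ r * (1 - e κ * e ((δ + l) * z)))

/-- `∑_{-δ < l ≤ L}` of the preceding summands. -/
def qPartialSum (r : ℂ) (γ δ κ lam : ℝ) (z : ℂ) (L : ℤ) : ℂ :=
  ∑ l ∈ Finset.Ioc ⌊-δ⌋ L, qTermSum r γ δ κ lam z l

/-- `τ → ∞` through the sector `|arg τ| ≤ θ`. -/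
def atInftySector (θ : ℝ) : Filter ℂ :=
  Bornology.cobounded ℂ ⊓ Filter.principal {τ : ℂ | |arg τ| ≤ θ}

/-- With `q = e(z)`, `z = iτ`, the `q`-series is a convergent asymptotic series as `τ → ∞` in
`|arg τ| < π / 2`: it is the sum of the series over `l`; the term with index `l` has exact order
`exp(-2π ⟨γ⟩' (δ + l) τ)`, and the error after the terms up to `L` is of the order of the first
omitted term. -/
structure IsAsymptoticQSeries (r : ℂ) (γ δ κ lam : ℝ) : Prop where
  hasSum : ∀ z : ℂ, 0 < z.im →
    HasSum (fun l : {l : ℤ // -δ < l} => qTermSum r γ δ κ lam z l) (qSeries r γ δ κ lam z)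
  order : ∀ θ < Real.pi / 2, ∀ l : ℤ, -δ < l →
    (fun τ : ℂ => qTermSum r γ δ κ lam (I * τ) l) =Θ[atInftySector θ]
      fun τ : ℂ => exp (-2 * Real.pi * fracPrime γ * (δ + l) * τ)
  remainder : ∀ θ < Real.pi / 2, ∀ L : ℤ, ⌊-δ⌋ ≤ L →
    (fun τ : ℂ => qSeries r γ δ κ lam (I * τ) - qPartialSum r γ δ κ lam (I * τ) L)
      =O[atInftySector θ]
      fun τ : ℂ => exp (-2 * Real.pi * fracPrime γ * (δ + (L + 1)) * τ)

end

end HolEis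

open HolEis

/-! For `Re s > 2` the lattice sum is taken row by row, over `m` for each fixed `n`. A row with
`β + n > 0` lies in the upper half-plane, where Lipschitz's formula (Poisson summation for
`y ↦ y ^ (s - 1) e(y w)`, with `w = α + (β + n) z`) turns it into a series of exponentials; a row
with `β + n < 0` becomes such a row under `u ↦ -u`, at the cost of a factor `exp(πis)`. The double
series so obtained are the two `q`-series, which converge for every `s`. If `β` is an integer there
is one further row, on the real axis: its positive part is a Lerch zeta-function, and the mean of
the two branches puts the factor `cos(πs)` on its negative part, which gives `𝓐(s, α, μ)`.

The Lerch zeta-functions are continued, and their functional equation is proved, by splitting them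
into even and odd parts, which are Mellin transforms of theta kernels with two characteristics. The
asymptotic expansion follows by summing the geometric series over `k` in the `q`-series: the terms
`T_l` so obtained decay exponentially in `l`, and the first omitted one bounds the remainder. -/

namespace HolEis

noncomputable section

open Topology Set MeasureTheory

/-! ### The exponential `e` and sums over `ℤ` -/

lemma e_zero : e 0 = 1 := by simp only [e, mul_zero, Complex.exp_zero]

lemma e_add (x y : ℂ) : e (x + y) = e x * e y := by
  simp only [e, mul_add, Complex.exp_add]

lemma e_neg (x : ℂ) : e (-x) = (e x)⁻¹ := by
  simp only [e, mul_neg, Complex.exp_neg]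

lemma e_nat_mul (n : ℕ) (x : ℂ) : e (n * x) = e x ^ n := by
  rw [e, e, ← Complex.exp_nat_mul]
  ring_nf

lemma e_ne_zero (x : ℂ) : e x ≠ 0 := Complex.exp_ne_zero _

lemma norm_e (x : ℂ) : ‖e x‖ = Real.exp (-(2 * Real.pi * x.im)) := by
  rw [e, Complex.norm_exp]
  congr 1
  simp

lemma norm_e_ofReal_mul (x : ℝ) (z : ℂ) : ‖e (x * z)‖ = Real.exp (-(2 * Real.pi * x * z.im)) := by
  rw [norm_e, im_ofReal_mul, ← mul_assoc]

lemma norm_e_ofReal (x : ℝ) : ‖e x‖ = 1 := by simp [norm_e]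

lemma IsInt.neg {x : ℝ} (h : IsInt x) : IsInt (-x) := by
  obtain ⟨n, rfl⟩ := h
  exact ⟨-n, by simp⟩

lemma isInt_neg {x : ℝ} : IsInt (-x) ↔ IsInt x :=
  ⟨fun h => by simpa using h.neg, IsInt.neg⟩

lemma isInt_of_add_intCast_eq_zero {x : ℝ} {n : ℤ} (h : x + n = 0) : IsInt x :=
  ⟨-n, by push_cast; linarith⟩

lemma delta_of_isInt {x : ℝ} (h : IsInt x) : delta x = 1 := if_pos h

lemma delta_of_not_isInt {x : ℝ} (h : ¬ IsInt x) : delta x = 0 := if_neg h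

lemma delta_neg (x : ℝ) : delta (-x) = delta x := by
  classical exact if_congr isInt_neg rfl rfl

lemma hasSum_ite_add_intCast_eq_zero (x : ℝ) (c : ℂ) :
    HasSum (fun n : ℤ => if x + n = 0 then c else 0) (delta x * c) := by
  by_cases hx : IsInt x
  · obtain ⟨k, rfl⟩ := hx
    have hk (n : ℤ) : (k + n : ℝ) = 0 ↔ n = -k := by
      rw [← Int.cast_add, Int.cast_eq_zero, add_comm, add_eq_zero_iff_eq_neg]
    simpa only [hk, delta_of_isInt ⟨k, rfl⟩, one_mul] using hasSum_ite_eq (-k) c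
  · have hx' (n : ℤ) : x + n ≠ 0 := fun h => hx (isInt_of_add_intCast_eq_zero h)
    simpa only [hx', if_false, delta_of_not_isInt hx, zero_mul] using hasSum_zero

lemma hasSum_int_of_hasSum_of_hasSum_neg {f : ℤ → ℂ} {x : ℝ} {a b c : ℂ}
    (hc : ∀ n : ℤ, x + n = 0 → f n = c)
    (ha : HasSum (fun n : {n : ℤ // -x < n} => f n) a)
    (hb : HasSum (fun n : {n : ℤ // -(-x) < n} => f (-n)) b) :
    HasSum f (delta x * c + a + b) := by
  have ha' := (hasSum_subtype_iff_indicator (s := {n : ℤ | -x < n}) (f := f)).mp ha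
  have hb' := (Equiv.neg ℤ).hasSum_iff.mpr <|
    (hasSum_subtype_iff_indicator (s := {n : ℤ | -(-x) < n}) (f := fun n => f (-n))).mp hb
  refine (((hasSum_ite_add_intCast_eq_zero x c).add ha').add hb').congr_fun fun n => ?_
  simp only [Function.comp_apply, Equiv.neg_apply, indicator_apply, mem_ofPred_eq, Int.cast_neg,
    neg_neg, neg_lt_iff_pos_add', lt_neg_iff_add_neg]
  rcases lt_trichotomy (x + n) 0 with h | h | h
  · simp only [h, h.ne, h.not_gt, if_true, if_false, zero_add]
  · simp only [h, lt_irrefl, if_true, if_false, add_zero, hc n h]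
  · simp only [h, h.ne', h.not_gt, if_true, if_false, zero_add, add_zero]

lemma hasSum_of_hasSum_prod_of_hasSum_fst {ι κ E : Type*} [AddCommMonoid E] [TopologicalSpace E]
    [ContinuousAdd E] [RegularSpace E] {f : ι → κ → E} {g : κ → E} {a : E}
    (ha : HasSum (fun p : ι × κ => f p.1 p.2) a) (hg : ∀ k, HasSum (fun i => f i k) (g k)) :
    HasSum g a :=
  ((Equiv.prodComm κ ι).hasSum_iff.mpr ha).prod_fiberwise hg

/-! ### Identity theorem and removable singularities -/

lemma eq_of_eq_of_lt_re {f g : ℂ → ℂ} {c : ℂ} {x : ℝ} (hf : DifferentiableOn ℂ f {c}ᶜ)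
    (hg : DifferentiableOn ℂ g {c}ᶜ) (h : ∀ s : ℂ, x < s.re → f s = g s) {s : ℂ} (hs : s ≠ c) :
    f s = g s := by
  have hconn : IsPreconnected ({c}ᶜ : Set ℂ) :=
    (isConnected_compl_singleton_of_one_lt_rank (by simp) c).isPreconnected
  have hopen : IsOpen ({c}ᶜ : Set ℂ) := isOpen_compl_singleton
  obtain ⟨y, hy⟩ := exists_gt (max x c.re)
  have hyc : (y : ℂ) ≠ c := fun h => (max_lt_iff.mp hy).2.ne' (by rw [← h, ofReal_re])
  refine (hf.analyticOnNhd hopen).eqOn_of_preconnected_of_eventuallyEq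
    (hg.analyticOnNhd hopen) hconn hyc ?_ hs
  filter_upwards [(isOpen_lt continuous_const continuous_re).mem_nhds (max_lt_iff.mp hy).1]
    with s hs using h s hs

lemma eq_of_eq_of_lt_re_of_differentiable {f g : ℂ → ℂ} {x : ℝ} (hf : Differentiable ℂ f)
    (hg : Differentiable ℂ g) (h : ∀ s : ℂ, x < s.re → f s = g s) (s : ℂ) : f s = g s :=
  eq_of_eq_of_lt_re (c := s + 1) hf.differentiableOn hg.differentiableOn h (by simp)

lemma ne_zero_of_one_lt_re {s : ℂ} (hs : 1 < s.re) : s ≠ 0 := by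
  rintro rfl
  exact absurd hs (by norm_num)

lemma ne_one_of_one_lt_re {s : ℂ} (hs : 1 < s.re) : s ≠ 1 := by
  rintro rfl
  exact absurd hs (by norm_num)

lemma ne_neg_natCast_of_re_pos {s : ℂ} (hs : 0 < s.re) (n : ℕ) : s ≠ -n := by
  rintro rfl
  exact absurd hs (by simp)

lemma differentiable_update_limUnder {E : Type*} [NormedAddCommGroup E] [NormedSpace ℂ E]
    [CompleteSpace E] {f : ℂ → E} {c : ℂ} (hf : DifferentiableOn ℂ f {c}ᶜ)
    (h : Tendsto (fun s => (s - c) • f s) (𝓝[≠] c) (𝓝 0)) :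
    Differentiable ℂ (Function.update f c (limUnder (𝓝[≠] c) f)) := by
  have hne : ∀ᶠ s in 𝓝[≠] c, s - c ≠ 0 := by
    filter_upwards [self_mem_nhdsWithin] with s hs using sub_ne_zero.mpr hs
  have hlim : Tendsto (fun s => s - c) (𝓝[≠] c) (𝓝 0) := by
    have : Continuous fun s : ℂ => s - c := by fun_prop
    simpa only [sub_self] using (this.tendsto c).mono_left nhdsWithin_le_nhds
  have hf0 : f =o[𝓝[≠] c] fun s => (s - c)⁻¹ := by
    refine ((isBigO_refl (fun s => (s - c)⁻¹) _).smul_isLittleO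
      ((isLittleO_one_iff ℂ).mpr h)).congr' ?_ (.of_forall fun s => mul_one _)
    filter_upwards [hne] with s hs using inv_smul_smul₀ hs _
  have hc : (fun _ => f c) =o[𝓝[≠] c] fun s => (s - c)⁻¹ :=
    isLittleO_const_left.mpr <| .inr <| tendsto_norm_inv_nhdsNE_zero_atTop.comp <|
      tendsto_nhdsWithin_iff.mpr ⟨hlim, hne⟩
  exact differentiableOn_univ.mp <|
    Complex.differentiableOn_update_limUnder_of_isLittleO univ_mem
      (by rwa [← compl_eq_univ_sdiff]) (hf0.sub hc)

/-! ### Theta kernels with two characteristics -/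

/-- The theta kernel `∑ n, e((a + n) b) exp(-π (a + n) ^ 2 t)`, whose Mellin transform is the
Lerch zeta-function summed over both signs of `a + n`; it is written through `jacobiTheta₂` so that
the inversion `t ↦ 1 / t` follows from the functional equation of the latter. -/
def evenThetaKernel (a b t : ℝ) : ℂ :=
  e (a * b) * exp (-Real.pi * a ^ 2 * t) * jacobiTheta₂ (b + a * I * t) (I * t)

/-- The theta kernel `∑ n, e((a + n) b) (a + n) exp(-π (a + n) ^ 2 t)`, the odd companion of
`evenThetaKernel`. -/
def oddThetaKernel (a b t : ℝ) : ℂ :=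
  e (a * b) * exp (-Real.pi * a ^ 2 * t) *
    (jacobiTheta₂' (b + a * I * t) (I * t) / (2 * Real.pi * I) +
      a * jacobiTheta₂ (b + a * I * t) (I * t))

lemma mul_jacobiTheta₂_term (a b t : ℝ) (n : ℤ) :
    e (a * b) * exp (-Real.pi * a ^ 2 * t) * jacobiTheta₂_term n (b + a * I * t) (I * t) =
      e ((n + a : ℝ) * b) * Real.exp (-Real.pi * (n + a) ^ 2 * t) := by
  rw [jacobiTheta₂_term, e, e, ofReal_exp, ← Complex.exp_add, ← Complex.exp_add,
    ← Complex.exp_add]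
  congr 1
  push_cast
  linear_combination (2 * Real.pi * n * a * t + Real.pi * n ^ 2 * t : ℂ) * I_mul_I

lemma hasSum_evenThetaKernel (a b : ℝ) {t : ℝ} (ht : 0 < t) :
    HasSum (fun n : ℤ => e ((n + a : ℝ) * b) * Real.exp (-Real.pi * (n + a) ^ 2 * t))
      (evenThetaKernel a b t) := by
  simp_rw [← mul_jacobiTheta₂_term]
  exact (hasSum_jacobiTheta₂_term _ (by simpa)).mul_left _

lemma hasSum_oddThetaKernel (a b : ℝ) {t : ℝ} (ht : 0 < t) :
    HasSum (fun n : ℤ => e ((n + a : ℝ) * b) * (n + a : ℝ) *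
      Real.exp (-Real.pi * (n + a) ^ 2 * t)) (oddThetaKernel a b t) := by
  have h1 := hasSum_jacobiTheta₂_term (b + a * I * t : ℂ) (τ := I * t) (by simpa)
  have h2 := hasSum_jacobiTheta₂'_term (b + a * I * t : ℂ) (τ := I * t) (by simpa)
  refine (((h2.div_const (2 * Real.pi * I)).add (h1.mul_left ↑a)).mul_left
    (e (a * b) * exp (-Real.pi * a ^ 2 * t))).congr_fun (fun n => ?_)
  rw [mul_right_comm, ← mul_jacobiTheta₂_term, jacobiTheta₂'_term,
    mul_assoc (2 * Real.pi * I : ℂ), mul_div_cancel_left₀ _ two_pi_I_ne_zero]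
  push_cast
  ring

lemma hasSum_evenThetaKernel_sub_delta (a b : ℝ) {t : ℝ} (ht : 0 < t) :
    HasSum (fun n : ℤ => if (n + a : ℝ) = 0 then 0 else
      e ((n + a : ℝ) * b) * Real.exp (-Real.pi * (n + a) ^ 2 * t))
      (evenThetaKernel a b t - delta a) := by
  have h := (hasSum_evenThetaKernel a b ht).sub (hasSum_ite_add_intCast_eq_zero a 1)
  rw [mul_one] at h
  refine h.congr_fun fun n => ?_
  rw [add_comm a]
  split_ifs with hn
  · simp [hn, e_zero]
  · rw [sub_zero]

lemma continuousOn_jacobiTheta₂_comp (a b : ℝ) :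
    ContinuousOn (fun t : ℝ => jacobiTheta₂ (b + a * I * t) (I * t)) (Ioi 0) :=
  continuousOn_of_forall_continuousAt fun t ht =>
    (continuousAt_jacobiTheta₂ (b + a * I * t) (by simpa)).comp
      (f := fun u : ℝ => ((b + a * I * u : ℂ), I * (u : ℂ))) (by fun_prop)

lemma continuousOn_jacobiTheta₂'_comp (a b : ℝ) :
    ContinuousOn (fun t : ℝ => jacobiTheta₂' (b + a * I * t) (I * t)) (Ioi 0) :=
  continuousOn_of_forall_continuousAt fun t ht =>
    (continuousAt_jacobiTheta₂' (b + a * I * t) (by simpa)).comp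
      (f := fun u : ℝ => ((b + a * I * u : ℂ), I * (u : ℂ))) (by fun_prop)

lemma continuousOn_evenThetaKernel (a b : ℝ) : ContinuousOn (evenThetaKernel a b) (Ioi 0) :=
  .mul (by fun_prop) (continuousOn_jacobiTheta₂_comp a b)

lemma continuousOn_oddThetaKernel (a b : ℝ) : ContinuousOn (oddThetaKernel a b) (Ioi 0) :=
  .mul (by fun_prop) <| ((continuousOn_jacobiTheta₂'_comp a b).div_const _).add <|
    continuousOn_const.mul (continuousOn_jacobiTheta₂_comp a b)

section inversion

variable (a b : ℝ) {t : ℝ} (ht : 0 < t)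
include ht

lemma one_div_neg_I_mul_cpow :
    1 / (-I * (I * (1 / t : ℝ))) ^ (1 / 2 : ℂ) = ((t ^ (1 / 2 : ℝ) : ℝ) : ℂ) := by
  have hbase : -I * (I * (1 / t : ℝ)) = ((t⁻¹ : ℝ) : ℂ) := by
    rw [← mul_assoc, neg_mul, I_mul_I, neg_neg, one_mul, one_div]
  have hexp : (1 / 2 : ℂ) = ((1 / 2 : ℝ) : ℂ) := by push_cast; rfl
  rw [hbase, hexp, ← ofReal_cpow (inv_nonneg.mpr ht.le), Real.inv_rpow ht.le, ofReal_inv, one_div,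
    inv_inv]

lemma div_I_mul_one_div :
    (b + a * I * (1 / t : ℝ)) / (I * (1 / t : ℝ)) = a + (-b : ℝ) * I * t := by
  have ht' : (t : ℂ) ≠ 0 := ofReal_ne_zero.mpr ht.ne'
  push_cast
  field_simp
  linear_combination ((b : ℂ) * t) * I_sq

lemma neg_one_div_I_mul_one_div : -1 / (I * (1 / t : ℝ)) = I * t := by
  have ht' : (t : ℂ) ≠ 0 := ofReal_ne_zero.mpr ht.ne'
  push_cast
  field_simp
  linear_combination -I_sq

lemma jacobiTheta₂_inversion :
    jacobiTheta₂ (b + a * I * (1 / t : ℝ)) (I * (1 / t : ℝ)) =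
      (t ^ (1 / 2 : ℝ) : ℝ) * exp (-Real.pi * I * (b + a * I * (1 / t : ℝ)) ^ 2 /
        (I * (1 / t : ℝ))) * jacobiTheta₂ (a + (-b : ℝ) * I * t) (I * t) := by
  rw [jacobiTheta₂_functional_equation, one_div_neg_I_mul_cpow ht, div_I_mul_one_div a b ht,
    neg_one_div_I_mul_one_div ht]

lemma jacobiTheta₂'_inversion :
    jacobiTheta₂' (b + a * I * (1 / t : ℝ)) (I * (1 / t : ℝ)) =
      (t ^ (1 / 2 : ℝ) : ℝ) * exp (-Real.pi * I * (b + a * I * (1 / t : ℝ)) ^ 2 /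
        (I * (1 / t : ℝ))) * (-I * t) * (jacobiTheta₂' (a + (-b : ℝ) * I * t) (I * t) -
          2 * Real.pi * I * (b + a * I * (1 / t : ℝ)) *
            jacobiTheta₂ (a + (-b : ℝ) * I * t) (I * t)) := by
  have ht' : (t : ℂ) ≠ 0 := ofReal_ne_zero.mpr ht.ne'
  have hdiv (x y : ℂ) : x / (I * (1 / t : ℝ)) * y = x * (-I * t) * y := by
    push_cast
    field_simp
    linear_combination (x * y) * I_sq
  rw [jacobiTheta₂'_functional_equation, one_div_neg_I_mul_cpow ht, div_I_mul_one_div a b ht,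
    neg_one_div_I_mul_one_div ht, hdiv]

lemma exp_mul_exp_inversion :
    exp (-Real.pi * a ^ 2 * (1 / t : ℝ)) * exp (-Real.pi * I * (b + a * I * (1 / t : ℝ)) ^ 2 /
        (I * (1 / t : ℝ))) = e ((-b : ℝ) * a) * exp (-Real.pi * (-b : ℝ) ^ 2 * t) := by
  have ht' : (t : ℂ) ≠ 0 := ofReal_ne_zero.mpr ht.ne'
  rw [e, ← Complex.exp_add, ← Complex.exp_add]
  congr 1
  push_cast
  field_simp
  linear_combination (-a ^ 2 : ℂ) * I_sq

lemma evenThetaKernel_inversion :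
    evenThetaKernel a b (1 / t) =
      e (a * b) * (t ^ (1 / 2 : ℝ) : ℝ) * evenThetaKernel (-b) a t := by
  rw [evenThetaKernel, evenThetaKernel, jacobiTheta₂_inversion a b ht]
  linear_combination (e (a * b) * (t ^ (1 / 2 : ℝ) : ℝ) *
    jacobiTheta₂ (a + (-b : ℝ) * I * t) (I * t)) * exp_mul_exp_inversion a b ht

lemma oddThetaKernel_inversion :
    oddThetaKernel a b (1 / t) =
      (-I * e (a * b)) * (t ^ (3 / 2 : ℝ) : ℝ) * oddThetaKernel (-b) a t := by
  have ht' : (t : ℂ) ≠ 0 := ofReal_ne_zero.mpr ht.ne'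
  have hpi : (Real.pi : ℂ) ≠ 0 := ofReal_ne_zero.mpr Real.pi_ne_zero
  have hpow : ((t ^ (3 / 2 : ℝ) : ℝ) : ℂ) = (t ^ (1 / 2 : ℝ) : ℝ) * t := by
    rw [← ofReal_mul, ← Real.rpow_add_one ht.ne']
    norm_num
  have hlin (J J' : ℂ) : -I * t * (J' - 2 * Real.pi * I * (b + a * I * (1 / t : ℝ)) * J) /
      (2 * Real.pi * I) + a * J = -I * t * (J' / (2 * Real.pi * I) + (-b : ℝ) * J) := by
    push_cast
    field_simp
    linear_combination (2 * a * Real.pi * J : ℂ) * I_sq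
  set J := jacobiTheta₂ (a + (-b : ℝ) * I * t) (I * t) with hJ
  set J' := jacobiTheta₂' (a + (-b : ℝ) * I * t) (I * t) with hJ'
  rw [oddThetaKernel, oddThetaKernel, jacobiTheta₂_inversion a b ht,
    jacobiTheta₂'_inversion a b ht, hpow, ← hJ, ← hJ']
  linear_combination
    (-I * e (a * b) * ((t ^ (1 / 2 : ℝ) : ℝ) * t) * (J' / (2 * Real.pi * I) + (-b : ℝ) * J)) *
      exp_mul_exp_inversion a b ht +
    (e (a * b) * (t ^ (1 / 2 : ℝ) : ℝ) * exp (-Real.pi * a ^ 2 * (1 / t : ℝ)) *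
      exp (-Real.pi * I * (b + a * I * (1 / t : ℝ)) ^ 2 / (I * (1 / t : ℝ)))) * hlin J J'

end inversion

lemma isBigO_evenThetaKernel_sub (a b r : ℝ) :
    (fun t => evenThetaKernel a b t - delta a) =O[atTop] fun t : ℝ => t ^ r := by
  obtain ⟨p, hp, hdecay⟩ := HurwitzZeta.isBigO_atTop_evenKernel_sub (a : UnitAddCircle)
  refine (IsBigO.trans (Eventually.isBigO ?_) hdecay).trans
    (isLittleO_exp_neg_mul_rpow_atTop hp _).isBigO
  filter_upwards [eventually_gt_atTop 0] with t ht
  rw [← (hasSum_evenThetaKernel_sub_delta a b ht).tsum_eq]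
  refine tsum_of_norm_bounded (HurwitzZeta.hasSum_int_evenKernel₀ a ht) fun n => ?_
  split_ifs
  · rw [norm_zero]
  · rw [norm_mul, ← ofReal_mul, norm_e_ofReal, one_mul, norm_real, Real.norm_of_nonneg
      (Real.exp_pos _).le]

lemma isBigO_oddThetaKernel (a b r : ℝ) :
    oddThetaKernel a b =O[atTop] fun t : ℝ => t ^ r := by
  obtain ⟨p, hp, hdecay⟩ := HurwitzKernelBounds.isBigO_atTop_F_int_one (a : UnitAddCircle)
  refine (IsBigO.trans (Eventually.isBigO ?_) hdecay).trans
    (isLittleO_exp_neg_mul_rpow_atTop hp _).isBigO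
  filter_upwards [eventually_gt_atTop 0] with t ht
  rw [← (hasSum_oddThetaKernel a b ht).tsum_eq]
  refine (norm_tsum_le_tsum_norm (hasSum_oddThetaKernel a b ht).summable.norm).trans (le_of_eq ?_)
  simp only [HurwitzKernelBounds.F_int, Function.Periodic.lift_coe]
  refine tsum_congr fun n => ?_
  rw [norm_mul, norm_mul, ← ofReal_mul, norm_e_ofReal, one_mul, norm_real, norm_real,
    Real.norm_of_nonneg (Real.exp_pos _).le, HurwitzKernelBounds.f_int, pow_one, Real.norm_eq_abs]

/-- The even kernels with characteristics `(a, b)` and `(-b, a)`, as a pair related by the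
inversion `t ↦ 1 / t`; it provides the continuation and the functional equation of `evenLerch`. -/
@[simps]
def evenPair (a b : ℝ) : WeakFEPair ℂ where
  f := evenThetaKernel a b
  g := evenThetaKernel (-b) a
  k := 1 / 2
  ε := e (a * b)
  f₀ := delta a
  g₀ := delta (-b)
  hf_int := (continuousOn_evenThetaKernel a b).locallyIntegrableOn measurableSet_Ioi
  hg_int := (continuousOn_evenThetaKernel (-b) a).locallyIntegrableOn measurableSet_Ioi
  hk := one_half_pos
  hε := e_ne_zero _
  h_feq _ hx := evenThetaKernel_inversion a b hx
  hf_top := isBigO_evenThetaKernel_sub a b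
  hg_top := isBigO_evenThetaKernel_sub (-b) a

/-- The odd kernels with characteristics `(a, b)` and `(-b, a)`, as a pair related by the
inversion `t ↦ 1 / t`; it provides the continuation and the functional equation of `oddLerch`. -/
@[simps]
def oddPair (a b : ℝ) : WeakFEPair ℂ where
  f := oddThetaKernel a b
  g := oddThetaKernel (-b) a
  k := 3 / 2
  ε := -I * e (a * b)
  f₀ := 0
  g₀ := 0
  hf_int := (continuousOn_oddThetaKernel a b).locallyIntegrableOn measurableSet_Ioi
  hg_int := (continuousOn_oddThetaKernel (-b) a).locallyIntegrableOn measurableSet_Ioi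
  hk := by norm_num
  hε := mul_ne_zero (neg_ne_zero.mpr I_ne_zero) (e_ne_zero _)
  h_feq _ hx := oddThetaKernel_inversion a b hx
  hf_top := by simpa only [sub_zero] using isBigO_oddThetaKernel a b
  hg_top := by simpa only [sub_zero] using isBigO_oddThetaKernel (-b) a

lemma evenPair_symm_Λ (a b : ℝ) (s : ℂ) : (evenPair a b).symm.Λ s = (evenPair (-b) a).Λ s := by
  have hε : (e (a * b))⁻¹ = e (((-b : ℝ) : ℂ) * a) := by
    rw [← e_neg, ofReal_neg, neg_mul, mul_comm]
  simp only [WeakFEPair.Λ, WeakFEPair.Λ₀, WeakFEPair.f_modif, WeakFEPair.symm_f, WeakFEPair.symm_k,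
    WeakFEPair.symm_ε, WeakFEPair.symm_f₀, WeakFEPair.symm_g₀, evenPair_f, evenPair_g, evenPair_k,
    evenPair_ε, evenPair_f₀, evenPair_g₀, hε, delta_neg a]

lemma oddPair_symm_Λ (a b : ℝ) (s : ℂ) : (oddPair a b).symm.Λ s = (oddPair (-b) a).Λ s := by
  simp only [WeakFEPair.Λ, WeakFEPair.Λ₀, WeakFEPair.f_modif, WeakFEPair.symm_f, WeakFEPair.symm_k,
    WeakFEPair.symm_f₀, WeakFEPair.symm_g₀, oddPair_f, oddPair_g, oddPair_k,
    oddPair_f₀, oddPair_g₀, smul_zero]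

/-! ### The even and odd Lerch zeta-functions -/

/-- The function `∑ n, e((a + n) b) / |a + n| ^ s`, continued to the plane. For `s ≠ 0` it is
`(evenPair a b).Λ (s / 2) / Gammaℝ s`; the pole of `Λ` at `s = 0` is here cancelled against the zero
of `1 / Gammaℝ s`, so that the definition is also right at that point. -/
def evenLerch (a b : ℝ) (s : ℂ) : ℂ :=
  ((evenPair a b).Λ₀ (s / 2) - 2 * e (a * b) * delta b / (1 - s)) * (Gammaℝ s)⁻¹ -
    delta a / Real.pi * (Gammaℝ (s + 2))⁻¹

/-- The function `∑ n, e((a + n) b) sign (a + n) / |a + n| ^ s`, continued to the plane. -/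
def oddLerch (a b : ℝ) (s : ℂ) : ℂ :=
  (oddPair a b).Λ ((s + 1) / 2) * (Gammaℝ (s + 1))⁻¹

lemma evenLerch_eq (a b : ℝ) {s : ℂ} (hs : s ≠ 0) :
    evenLerch a b s = (evenPair a b).Λ (s / 2) * (Gammaℝ s)⁻¹ := by
  have hpi : (Real.pi : ℂ) ≠ 0 := ofReal_ne_zero.mpr Real.pi_ne_zero
  have hhalf : ((1 / 2 : ℝ) : ℂ) - s / 2 = (1 - s) / 2 := by
    push_cast
    ring
  simp only [evenLerch, WeakFEPair.Λ, Gammaℝ_add_two hs, evenPair_f₀, evenPair_g₀, evenPair_ε,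
    evenPair_k, smul_eq_mul, delta_neg, hhalf, div_div_eq_mul_div]
  field_simp
  ring

lemma differentiable_Λ₀_evenPair_half (a b : ℝ) :
    Differentiable ℂ fun s => (evenPair a b).Λ₀ (s / 2) :=
  (evenPair a b).differentiable_Λ₀.comp (differentiable_id.div_const 2)

lemma differentiable_Gammaℝ_add_inv (c : ℂ) : Differentiable ℂ fun s => (Gammaℝ (s + c))⁻¹ :=
  differentiable_Gammaℝ_inv.comp (differentiable_id.add_const c)

lemma differentiableAt_evenLerch (a b : ℝ) {s : ℂ} (hs : s ≠ 1 ∨ ¬ IsInt b) :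
    DifferentiableAt ℂ (evenLerch a b) s := by
  have hpole : DifferentiableAt ℂ (fun s => 2 * e (a * b) * delta b / (1 - s)) s := by
    rcases hs with hs | hs
    · exact (differentiableAt_const _).div (by fun_prop) (sub_ne_zero.mpr hs.symm)
    · simp only [delta_of_not_isInt hs, mul_zero, zero_div, differentiableAt_const]
  exact (((differentiable_Λ₀_evenPair_half a b s).sub hpole).mul (differentiable_Gammaℝ_inv s)).sub
    ((differentiable_Gammaℝ_add_inv 2 s).const_mul _)

lemma exists_differentiable_eq_sub_one_mul_evenLerch (a b : ℝ) :
    ∃ g : ℂ → ℂ, Differentiable ℂ g ∧ ∀ s ≠ 1, g s = (s - 1) * evenLerch a b s := by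
  refine ⟨fun s => ((s - 1) * (evenPair a b).Λ₀ (s / 2) + 2 * e (a * b) * delta b) *
    (Gammaℝ s)⁻¹ - (s - 1) * (delta a / Real.pi * (Gammaℝ (s + 2))⁻¹), ?_, fun s hs => ?_⟩
  · have hΛ := differentiable_Λ₀_evenPair_half a b
    have hG2 := differentiable_Gammaℝ_add_inv 2
    fun_prop
  · have hs' : 1 - s ≠ 0 := sub_ne_zero.mpr hs.symm
    simp only [evenLerch]
    field_simp
    ring

lemma meromorphicAt_evenLerch (a b : ℝ) : MeromorphicAt (evenLerch a b) 1 := by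
  obtain ⟨g, hg, hgs⟩ := exists_differentiable_eq_sub_one_mul_evenLerch a b
  have hg1 : MeromorphicAt g 1 := (hg.analyticAt 1).meromorphicAt
  refine MeromorphicAt.congr (f := fun s => g s / (s - 1)) (by fun_prop) ?_
  filter_upwards [self_mem_nhdsWithin] with s hs
  rw [hgs s hs, mul_div_cancel_left₀ _ (sub_ne_zero.mpr hs)]

lemma differentiable_oddLerch (a b : ℝ) : Differentiable ℂ (oddLerch a b) :=
  .mul (fun s => ((oddPair a b).differentiableAt_Λ (.inr rfl) (.inr rfl)).comp s
    (f := fun s => (s + 1) / 2) (by fun_prop)) (differentiable_Gammaℝ_add_inv 1)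

lemma summable_norm_e_div (a b : ℝ) {σ : ℝ} (hσ : 1 < σ) :
    Summable fun n : ℤ => ‖e ((n + a : ℝ) * b)‖ / |(n + a : ℝ)| ^ σ := by
  refine ((Real.summable_one_div_int_add_rpow a σ).mpr hσ).congr fun n => ?_
  rw [← ofReal_mul, norm_e_ofReal]

lemma hasSum_evenLerch (a b : ℝ) {s : ℂ} (hs : 1 < s.re) :
    HasSum (fun n : ℤ => e ((n + a : ℝ) * b) / ((|n + a| : ℝ) : ℂ) ^ s) (evenLerch a b s) := by
  have hs0 : s ≠ 0 := ne_zero_of_one_lt_re hs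
  have hG : Gammaℝ s ≠ 0 := Gammaℝ_ne_zero_of_re_pos (by linarith)
  have hsum := hasSum_mellin_pi_mul_sq (a := fun n : ℤ => e ((n + a : ℝ) * b))
    (r := fun n : ℤ => (n + a : ℝ)) (F := fun t => evenThetaKernel a b t - delta a) (s := s)
    (by linarith) (fun t ht => by simpa using! hasSum_evenThetaKernel_sub_delta a b ht)
    (summable_norm_e_div a b hs)
  have hmellin := ((evenPair a b).hasMellin (s := s / 2) (by simpa using by linarith)).2
  simp only [evenPair_f, evenPair_f₀] at hmellin
  rw [hmellin] at hsum
  rw [evenLerch_eq a b hs0]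
  refine (hsum.mul_right (Gammaℝ s)⁻¹).congr_fun fun n => ?_
  field_simp

lemma hasSum_oddLerch (a b : ℝ) {s : ℂ} (hs : 1 < s.re) :
    HasSum (fun n : ℤ => e ((n + a : ℝ) * b) * SignType.sign (n + a : ℝ) /
      ((|n + a| : ℝ) : ℂ) ^ s) (oddLerch a b s) := by
  have hG : Gammaℝ (s + 1) ≠ 0 := Gammaℝ_ne_zero_of_re_pos (by rw [add_re, one_re]; linarith)
  have hsum := hasSum_mellin_pi_mul_sq' (a := fun n : ℤ => e ((n + a : ℝ) * b))
    (r := fun n : ℤ => (n + a : ℝ)) (F := oddThetaKernel a b) (s := s)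
    (by linarith) (fun t ht => by simpa using! hasSum_oddThetaKernel a b ht)
    (summable_norm_e_div a b hs)
  have hmellin : mellin (oddThetaKernel a b) ((s + 1) / 2) = (oddPair a b).Λ ((s + 1) / 2) :=
    (IsStrongFEPair.hasMellin (P := oddPair a b) ⟨rfl, rfl⟩ ((s + 1) / 2)).2
  rw [hmellin] at hsum
  refine (hsum.mul_right (Gammaℝ (s + 1))⁻¹).congr_fun fun n => ?_
  field_simp

lemma evenLerch_one_sub (a b : ℝ) {s : ℂ} (hs : ∀ n : ℕ, s ≠ -n) (hs1 : s ≠ 1) :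
    e (a * b) * evenLerch (-b) a (1 - s) =
      Gammaℂ s * cos (Real.pi * s / 2) * evenLerch a b s := by
  have hs0 : s ≠ 0 := by simpa only [Nat.cast_zero, neg_zero] using hs 0
  have hhalf : ((1 / 2 : ℝ) : ℂ) - (1 - s) / 2 = s / 2 := by
    push_cast
    ring
  have hfe := (evenPair a b).functional_equation ((1 - s) / 2)
  rw [evenPair_symm_Λ, evenPair_k, evenPair_ε, smul_eq_mul, hhalf] at hfe
  rw [evenLerch_eq _ _ hs0, evenLerch_eq _ _ (sub_ne_zero.mpr hs1.symm), inv_Gammaℝ_one_sub hs,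
    hfe]
  ring

lemma oddLerch_one_sub (a b : ℝ) {s : ℂ} (hs : ∀ n : ℕ, s ≠ -n) :
    -I * e (a * b) * oddLerch (-b) a (1 - s) =
      Gammaℂ s * sin (Real.pi * s / 2) * oddLerch a b s := by
  have hhalf : ((3 / 2 : ℝ) : ℂ) - (1 - s + 1) / 2 = (s + 1) / 2 := by
    push_cast
    ring
  have hfe := (oddPair a b).functional_equation ((1 - s + 1) / 2)
  rw [oddPair_symm_Λ, oddPair_k, oddPair_ε, smul_eq_mul, hhalf] at hfe
  rw [oddLerch, oddLerch, sub_add_eq_add_sub, one_add_one_eq_two, inv_Gammaℝ_two_sub hs]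
  rw [sub_add_eq_add_sub, one_add_one_eq_two] at hfe
  rw [hfe]
  ring

lemma intCast_neg_add_neg (n : ℤ) (a : ℝ) : ((-n : ℤ) : ℝ) + -a = -(n + a) := by
  push_cast
  ring

lemma evenLerch_neg_neg (a b : ℝ) {s : ℂ} (hs : s ≠ 1) :
    evenLerch (-a) (-b) s = evenLerch a b s := by
  refine eq_of_eq_of_lt_re (c := 1) (x := 1)
    (fun _ h => (differentiableAt_evenLerch _ _ (.inl h)).differentiableWithinAt)
    (fun _ h => (differentiableAt_evenLerch _ _ (.inl h)).differentiableWithinAt)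
    (fun s hs => ?_) hs
  have h := (Equiv.neg ℤ).hasSum_iff.mpr (hasSum_evenLerch (-a) (-b) hs)
  refine (h.congr_fun fun n => ?_).unique (hasSum_evenLerch a b hs)
  simp only [Function.comp_apply, Equiv.neg_apply, intCast_neg_add_neg, abs_neg, ofReal_neg,
    neg_mul_neg]

lemma oddLerch_neg_neg (a b : ℝ) (s : ℂ) : oddLerch (-a) (-b) s = -oddLerch a b s := by
  refine eq_of_eq_of_lt_re_of_differentiable (x := 1) (differentiable_oddLerch _ _)
    (differentiable_oddLerch a b).neg (fun s hs => ?_) s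
  have h := (Equiv.neg ℤ).hasSum_iff.mpr (hasSum_oddLerch (-a) (-b) hs)
  refine (h.congr_fun fun n => ?_).unique (hasSum_oddLerch a b hs).neg
  simp only [Function.comp_apply, Equiv.neg_apply, intCast_neg_add_neg, abs_neg, Left.sign_neg,
    SignType.coe_neg, ofReal_neg, neg_mul_neg]
  rw [mul_neg, neg_div]

/-! ### Lerch's zeta-function and the function `𝓐` -/

/-- The continuation of `ψ(r, γ, κ)` obtained from theta functions; by uniqueness it agrees with
`lerchPsi` away from `r = 1`. -/
def lerchFun (γ κ : ℝ) (r : ℂ) : ℂ := (evenLerch γ κ r + oddLerch γ κ r) / 2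

lemma differentiableAt_lerchFun (γ κ : ℝ) {r : ℂ} (hr : r ≠ 1 ∨ ¬ IsInt κ) :
    DifferentiableAt ℂ (lerchFun γ κ) r :=
  ((differentiableAt_evenLerch γ κ hr).add (differentiable_oddLerch γ κ r)).div_const 2

lemma meromorphicAt_lerchFun (γ κ : ℝ) : MeromorphicAt (lerchFun γ κ) 1 := by
  have heven := meromorphicAt_evenLerch γ κ
  have hodd : MeromorphicAt (oddLerch γ κ) 1 :=
    ((differentiable_oddLerch γ κ).analyticAt 1).meromorphicAt
  unfold lerchFun
  fun_prop

lemma hasSum_lerchFun (γ κ : ℝ) {r : ℂ} (hr : 1 < r.re) :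
    HasSum (fun k : {k : ℤ // -γ < k} => psiTerm r γ κ k) (lerchFun γ κ r) := by
  have h := ((hasSum_evenLerch γ κ hr).add (hasSum_oddLerch γ κ hr)).div_const 2
  refine (hasSum_subtype_iff_indicator (s := {k : ℤ | -γ < k})
    (f := fun k => psiTerm r γ κ k)).mpr (h.congr_fun fun k => ?_)
  simp only [indicator_apply, mem_ofPred_eq, neg_lt_iff_pos_add, psiTerm,
    add_comm (γ : ℂ) (k : ℂ), ofReal_add, ofReal_intCast]
  rcases lt_trichotomy (k + γ : ℝ) 0 with hk | hk | hk
  · rw [if_neg hk.not_gt, sign_neg hk, SignType.coe_neg_one]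
    ring
  · simp [hk, ne_zero_of_one_lt_re hr]
  · rw [if_pos hk, sign_pos hk, SignType.coe_one, abs_of_pos hk]
    push_cast
    ring

lemma isLerchPsi_lerchFun (γ κ : ℝ) : IsLerchPsi γ κ (lerchFun γ κ) where
  hasSum _ hr := hasSum_lerchFun γ κ hr
  differentiableOn _ h := (differentiableAt_lerchFun γ κ (.inl h)).differentiableWithinAt
  meromorphicAt := meromorphicAt_lerchFun γ κ
  entire h _ := differentiableAt_lerchFun γ κ (.inr h)

lemma isLerchPsi_lerchPsi (γ κ : ℝ) : IsLerchPsi γ κ fun r => lerchPsi r γ κ :=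
  Classical.epsilon_spec (p := IsLerchPsi γ κ) ⟨_, isLerchPsi_lerchFun γ κ⟩

lemma lerchPsi_eq (γ κ : ℝ) {r : ℂ} (hr : r ≠ 1) : lerchPsi r γ κ = lerchFun γ κ r :=
  eq_of_eq_of_lt_re (c := 1) (x := 1) (isLerchPsi_lerchPsi γ κ).differentiableOn
    (isLerchPsi_lerchFun γ κ).differentiableOn (fun s hs =>
      ((isLerchPsi_lerchPsi γ κ).hasSum s hs).unique (hasSum_lerchFun γ κ hs)) hr

lemma lerchPsi_neg_neg (γ κ : ℝ) {r : ℂ} (hr : r ≠ 1) :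
    lerchPsi r (-γ) (-κ) = (evenLerch γ κ r - oddLerch γ κ r) / 2 := by
  rw [lerchPsi_eq _ _ hr, lerchFun, evenLerch_neg_neg _ _ hr, oddLerch_neg_neg, sub_eq_add_neg]

lemma differentiableAt_lerchPsi (γ κ : ℝ) {r : ℂ} (hr : r ≠ 1 ∨ ¬ IsInt κ) :
    DifferentiableAt ℂ (fun r => lerchPsi r γ κ) r := by
  rcases hr with hr | hr
  · exact (isLerchPsi_lerchPsi γ κ).differentiableOn.differentiableAt
      (isOpen_compl_singleton.mem_nhds hr)
  · exact (isLerchPsi_lerchPsi γ κ).entire hr r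

lemma differentiableAt_calA₀ (α μ : ℝ) {s : ℂ} (hs : s ≠ 1 ∨ ¬ IsInt μ) :
    DifferentiableAt ℂ (fun s => calA₀ s α μ) s := by
  have h := differentiableAt_lerchPsi α μ hs
  have hneg := differentiableAt_lerchPsi (-α) (-μ) (r := s) (by rwa [isInt_neg])
  unfold calA₀
  fun_prop

lemma calA₀_eq (α μ : ℝ) {s : ℂ} (hs : s ≠ 1) :
    calA₀ s α μ = cos (Real.pi * s / 2) ^ 2 * evenLerch α μ s +
      sin (Real.pi * s / 2) ^ 2 * oddLerch α μ s := by
  have hcos : cos (Real.pi * s) = 2 * cos (Real.pi * s / 2) ^ 2 - 1 := by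
    rw [← Complex.cos_two_mul, mul_div_cancel₀ _ two_ne_zero]
  rw [calA₀, lerchPsi_neg_neg _ _ hs, lerchPsi_eq _ _ hs, lerchFun, hcos, Complex.sin_sq]
  ring

-- The pole of `evenLerch` at `s = 1` is killed by the double zero of `cos (π s / 2) ^ 2`.
lemma tendsto_sub_one_mul_calA₀ (α μ : ℝ) :
    Tendsto (fun s => (s - 1) * calA₀ s α μ) (𝓝[≠] 1) (𝓝 0) := by
  obtain ⟨g, hg, hgs⟩ := exists_differentiable_eq_sub_one_mul_evenLerch α μ
  have hcont : Continuous fun s : ℂ => cos (Real.pi * s / 2) ^ 2 * g s +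
      (s - 1) * (sin (Real.pi * s / 2) ^ 2 * oddLerch α μ s) := by
    have := hg.continuous
    have := (differentiable_oddLerch α μ).continuous
    fun_prop
  have hlim := (hcont.tendsto 1).mono_left (nhdsWithin_le_nhds (s := {1}ᶜ))
  rw [mul_one, Complex.cos_pi_div_two, sub_self, zero_mul, zero_pow two_ne_zero, zero_mul,
    add_zero] at hlim
  refine hlim.congr' ?_
  filter_upwards [self_mem_nhdsWithin] with s hs
  rw [calA₀_eq α μ hs, hgs s hs]
  ring

lemma differentiable_calA (α μ : ℝ) : Differentiable ℂ fun s => calA s α μ :=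
  differentiable_update_limUnder
    (fun _ hs => (differentiableAt_calA₀ α μ (.inl hs)).differentiableWithinAt)
    (tendsto_sub_one_mul_calA₀ α μ)

lemma calA_of_ne_one (α μ : ℝ) {s : ℂ} (hs : s ≠ 1) : calA s α μ = calA₀ s α μ :=
  Function.update_of_ne hs _ _

lemma calA_eq_calA₀ (α μ : ℝ) {s : ℂ} (hs : s ≠ 1 ∨ ¬ IsInt μ) : calA s α μ = calA₀ s α μ := by
  rcases hs with hs | hs
  · exact calA_of_ne_one α μ hs
  · exact eq_of_eq_of_lt_re_of_differentiable (x := 1) (differentiable_calA α μ)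
      (fun s => differentiableAt_calA₀ α μ (.inr hs))
      (fun s h => calA_of_ne_one α μ (ne_one_of_one_lt_re h)) s

/-- The second expression for `𝓐(s, α, μ)`, to which the first is related by Lerch's functional
equation. -/
def calADual (s : ℂ) (α μ : ℝ) : ℂ :=
  e (α * μ) * ((2 * Real.pi : ℂ) ^ s * (2 * Gamma s)⁻¹) *
    (exp (-Real.pi * I * s / 2) * lerchPsi (1 - s) (-μ) α +
      exp (Real.pi * I * s / 2) * lerchPsi (1 - s) μ (-α))

lemma differentiable_two_pi_cpow : Differentiable ℂ fun s : ℂ => (2 * Real.pi : ℂ) ^ s :=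
  differentiable_id.const_cpow (.inl (by simp [Real.pi_ne_zero]))

lemma differentiableAt_calADual (α μ : ℝ) {s : ℂ} (hs : s ≠ 0 ∨ ¬ IsInt α) :
    DifferentiableAt ℂ (fun s => calADual s α μ) s := by
  have h1 : DifferentiableAt ℂ (fun s : ℂ => lerchPsi (1 - s) (-μ) α) s :=
    (differentiableAt_lerchPsi (-μ) α (r := 1 - s) (by simpa using hs)).comp s
      (f := fun s : ℂ => 1 - s) (by fun_prop)
  have h2 : DifferentiableAt ℂ (fun s : ℂ => lerchPsi (1 - s) μ (-α)) s :=
    (differentiableAt_lerchPsi μ (-α) (r := 1 - s) (by simpa [isInt_neg] using hs)).comp s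
      (f := fun s : ℂ => 1 - s) (by fun_prop)
  have hΓ := differentiable_one_div_Gamma
  have hpow := differentiable_two_pi_cpow
  simp only [calADual, mul_inv]
  fun_prop

lemma calA₀_eq_calADual (α μ : ℝ) {s : ℂ} (hs : ∀ n : ℕ, s ≠ -n) (hs1 : s ≠ 1) :
    calA₀ s α μ = calADual s α μ := by
  have hs0 : s ≠ 0 := by simpa only [Nat.cast_zero, neg_zero] using hs 0
  have hs2 : 1 - s ≠ 1 := by rwa [ne_eq, sub_eq_self]
  have hΓ : (2 * Real.pi : ℂ) ^ s * (2 * Gamma s)⁻¹ * Gammaℂ s = 1 := by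
    have hG : Gamma s ≠ 0 := Gamma_ne_zero hs
    have hpow : (2 * Real.pi : ℂ) ^ s ≠ 0 :=
      (cpow_ne_zero_iff_of_exponent_ne_zero hs0).mpr (by simp [Real.pi_ne_zero])
    rw [Gammaℂ_def, cpow_neg]
    field_simp
  have hψ := lerchPsi_neg_neg (-μ) α hs2
  rw [neg_neg] at hψ
  have hexp : exp (Real.pi * I * s / 2) = cos (Real.pi * s / 2) + sin (Real.pi * s / 2) * I := by
    rw [← exp_mul_I]
    ring_nf
  have hexp_neg :
      exp (-Real.pi * I * s / 2) = cos (Real.pi * s / 2) - sin (Real.pi * s / 2) * I := by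
    rw [sub_eq_add_neg, ← neg_mul, ← Complex.cos_neg, ← Complex.sin_neg, ← exp_mul_I]
    ring_nf
  rw [calA₀_eq α μ hs1, calADual, lerchPsi_eq _ _ hs2, hψ, lerchFun, hexp, hexp_neg]
  set K := (2 * Real.pi : ℂ) ^ s * (2 * Gamma s)⁻¹
  set C := cos (Real.pi * s / 2 : ℂ)
  set S := sin (Real.pi * s / 2 : ℂ)
  linear_combination (-K * C) * evenLerch_one_sub α μ hs hs1 + (-K * S) * oddLerch_one_sub α μ hs -
    (C ^ 2 * evenLerch α μ s + S ^ 2 * oddLerch α μ s) * hΓ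

lemma calA_eq_calADual (α μ : ℝ) {s : ℂ} (hs : s ≠ 0 ∨ ¬ IsInt α) :
    calA s α μ = calADual s α μ := by
  have h (s : ℂ) (hs : 1 < s.re) : calA s α μ = calADual s α μ := by
    rw [calA_of_ne_one α μ (ne_one_of_one_lt_re hs)]
    exact calA₀_eq_calADual α μ (ne_neg_natCast_of_re_pos (by linarith)) (ne_one_of_one_lt_re hs)
  rcases hs with hs | hs
  · exact eq_of_eq_of_lt_re (c := 0) (differentiable_calA α μ).differentiableOn
      (fun s hs => (differentiableAt_calADual α μ (.inl hs)).differentiableWithinAt) h hs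
  · exact eq_of_eq_of_lt_re_of_differentiable (differentiable_calA α μ)
      (fun s => differentiableAt_calADual α μ (.inr hs)) h s

/-! ### Complex powers -/

lemma powPlus_eq_cpow {w : ℂ} (hw : w ≠ 0) (s : ℂ) : powPlus w s = w ^ s := by
  rw [powPlus, cpow_def_of_ne_zero hw, log, mul_comm]

lemma powMinus_eq_powPlus {w : ℂ} (hw : arg w ≠ Real.pi) (s : ℂ) :
    powMinus w s = powPlus w s := by
  rw [powMinus, argMinus, if_neg hw, powPlus]

lemma norm_inv_exp_mul_log_add_le {w s : ℂ} (hw : w ≠ 0) {x : ℝ} (hx : |x| ≤ Real.pi) :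
    ‖(exp (s * (Real.log ‖w‖ + x * I)))⁻¹‖ ≤ ‖w‖ ^ (-s.re) * Real.exp (Real.pi * |s.im|) := by
  have him : s.im * x ≤ Real.pi * |s.im| :=
    calc s.im * x ≤ |s.im * x| := le_abs_self _
      _ = |x| * |s.im| := by rw [abs_mul, mul_comm]
      _ ≤ Real.pi * |s.im| := by gcongr
  have hre : (s * (Real.log ‖w‖ + x * I)).re = s.re * Real.log ‖w‖ - s.im * x := by simp
  rw [norm_inv, Complex.norm_exp, ← Real.exp_neg, Real.rpow_def_of_pos (norm_pos_iff.mpr hw),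
    ← Real.exp_add, Real.exp_le_exp, hre]
  linarith

lemma norm_inv_powPlus_le {w : ℂ} (s : ℂ) (hw : w ≠ 0) :
    ‖(powPlus w s)⁻¹‖ ≤ ‖w‖ ^ (-s.re) * Real.exp (Real.pi * |s.im|) :=
  norm_inv_exp_mul_log_add_le hw (abs_arg_le_pi w)

lemma abs_argMinus_le_pi (w : ℂ) : |argMinus w| ≤ Real.pi := by
  rw [argMinus]
  split_ifs
  · rw [abs_neg, abs_of_pos Real.pi_pos]
  · exact abs_arg_le_pi w

lemma norm_inv_powMinus_le {w : ℂ} (s : ℂ) (hw : w ≠ 0) :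
    ‖(powMinus w s)⁻¹‖ ≤ ‖w‖ ^ (-s.re) * Real.exp (Real.pi * |s.im|) :=
  norm_inv_exp_mul_log_add_le hw (abs_argMinus_le_pi w)

lemma neg_two_pi_I_mul_cpow {w : ℂ} (hw : 0 < w.im) (s : ℂ) :
    (-(2 * Real.pi * I * w)) ^ s = (2 * Real.pi : ℂ) ^ s * exp (-Real.pi * I * s / 2) * w ^ s := by
  have hw0 : w ≠ 0 := fun h => hw.ne' (by rw [h, zero_im])
  have harg : arg (-I) + arg w ∈ Ioc (-Real.pi) Real.pi := by
    rw [arg_neg_I]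
    constructor <;> linarith [arg_nonneg_iff.mpr hw.le, arg_le_pi w, Real.pi_pos]
  have hpi : (2 * Real.pi : ℂ) = ((2 * Real.pi : ℝ) : ℂ) := by push_cast; rfl
  have hlog : log (-(2 * Real.pi * I * w)) =
      log (2 * Real.pi : ℂ) + (-(Real.pi / 2) * I + log w) := by
    rw [← log_neg_I, ← log_mul (neg_ne_zero.mpr I_ne_zero) hw0 harg, hpi,
      ← ofReal_log (by positivity), ← log_ofReal_mul (by positivity)
        (mul_ne_zero (neg_ne_zero.mpr I_ne_zero) hw0)]
    ring_nf
  have hpi0 : (2 * Real.pi : ℂ) ≠ 0 := by simp [Real.pi_ne_zero]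
  rw [cpow_def_of_ne_zero (neg_ne_zero.mpr (mul_ne_zero (mul_ne_zero hpi0 I_ne_zero) hw0)),
    cpow_def_of_ne_zero hpi0, cpow_def_of_ne_zero hw0, hlog, ← Complex.exp_add, ← Complex.exp_add]
  ring_nf

/-! ### The Laplace transform of a power -/

lemma continuousOn_cpow_sub_one_mul_exp (a r : ℂ) :
    ContinuousOn (fun t : ℝ => (t : ℂ) ^ (a - 1) * exp (-(r * t))) (Ioi 0) :=
  ContinuousOn.mul (fun _ ht => (continuousAt_ofReal_cpow_const _ _
    (.inr (ne_of_gt ht))).continuousWithinAt) (by fun_prop)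

lemma norm_cpow_sub_one_mul_exp (a r : ℂ) {t : ℝ} (ht : 0 < t) :
    ‖(t : ℂ) ^ (a - 1) * exp (-(r * t))‖ = t ^ (a.re - 1) * Real.exp (-r.re * t) := by
  rw [norm_mul, norm_cpow_eq_rpow_re_of_pos ht, Complex.norm_exp]
  simp

lemma integrableOn_cpow_sub_one_mul_exp {a r : ℂ} (ha : 0 < a.re) (hr : 0 < r.re) :
    IntegrableOn (fun t : ℝ => (t : ℂ) ^ (a - 1) * exp (-(r * t))) (Ioi 0) := by
  have h := integrableOn_rpow_mul_exp_neg_mul_rpow (p := 1) (s := a.re - 1) (b := r.re)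
    (by linarith) one_pos hr
  refine h.mono' ((continuousOn_cpow_sub_one_mul_exp a r).aestronglyMeasurable
    measurableSet_Ioi) ?_
  filter_upwards [ae_restrict_mem measurableSet_Ioi] with t ht
  rw [norm_cpow_sub_one_mul_exp a r ht, Real.rpow_one]

lemma differentiableAt_integral_cpow_sub_one_mul_exp {a r : ℂ} (ha : 0 < a.re) (hr : 0 < r.re) :
    DifferentiableAt ℂ (fun r : ℂ => ∫ t : ℝ in Ioi 0, (t : ℂ) ^ (a - 1) * exp (-(r * t))) r := by
  have hre {x : ℂ} (hx : x ∈ Metric.ball r (r.re / 2)) : r.re / 2 < x.re := by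
    have h := (abs_re_le_norm (x - r)).trans_lt (mem_ball_iff_norm.mp hx)
    rw [sub_re, abs_lt] at h
    linarith
  have hbound {t : ℝ} (ht : 0 < t) {x : ℂ} (hx : x ∈ Metric.ball r (r.re / 2)) :
      ‖(t : ℂ) ^ (a - 1) * exp (-(x * t)) * -t‖ ≤
        t ^ a.re * Real.exp (-(r.re / 2) * t ^ (1 : ℝ)) := by
    rw [norm_mul, norm_cpow_sub_one_mul_exp a x ht, norm_neg, norm_real, Real.norm_of_nonneg ht.le,
      mul_right_comm, ← Real.rpow_add_one ht.ne', sub_add_cancel, Real.rpow_one]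
    gcongr
    exact (hre hx).le
  have hderiv (t : ℝ) (x : ℂ) : HasDerivAt (fun x : ℂ => (t : ℂ) ^ (a - 1) * exp (-(x * t)))
      ((t : ℂ) ^ (a - 1) * exp (-(x * t)) * -t) x := by
    have h : HasDerivAt (fun x : ℂ => -(x * t)) (-t) x := by
      simpa using! ((hasDerivAt_id x).mul_const (t : ℂ)).neg
    rw [mul_assoc]
    exact h.cexp.const_mul _
  have hmeas (x : ℂ) := (continuousOn_cpow_sub_one_mul_exp a x).aestronglyMeasurable
    (μ := volume) measurableSet_Ioi
  refine (hasDerivAt_integral_of_dominated_loc_of_deriv_le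
    (bound := fun t => t ^ a.re * Real.exp (-(r.re / 2) * t ^ (1 : ℝ)))
    (Metric.ball_mem_nhds r (half_pos hr)) (.of_forall hmeas)
    (integrableOn_cpow_sub_one_mul_exp ha hr) ((hmeas r).mul (by fun_prop)) ?_
    (integrableOn_rpow_mul_exp_neg_mul_rpow (by linarith) one_pos (by linarith))
    (.of_forall fun t x _ => hderiv t x)).2.differentiableAt
  filter_upwards [ae_restrict_mem measurableSet_Ioi] with t ht x hx using hbound ht hx

-- By the identity theorem from the case of real `r`.
lemma integral_cpow_sub_one_mul_exp {a r : ℂ} (ha : 0 < a.re) (hr : 0 < r.re) :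
    ∫ t : ℝ in Ioi 0, (t : ℂ) ^ (a - 1) * exp (-(r * t)) = Gamma a / r ^ a := by
  have hopen : IsOpen {r : ℂ | 0 < r.re} := isOpen_lt continuous_const continuous_re
  have hslit {r : ℂ} (hr : 0 < r.re) : r ∈ slitPlane := .inl hr
  have hint : AnalyticOnNhd ℂ
      (fun r : ℂ => ∫ t : ℝ in Ioi 0, (t : ℂ) ^ (a - 1) * exp (-(r * t))) {r : ℂ | 0 < r.re} :=
    DifferentiableOn.analyticOnNhd (fun r hr =>
      (differentiableAt_integral_cpow_sub_one_mul_exp ha hr).differentiableWithinAt) hopen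
  have hpow : AnalyticOnNhd ℂ (fun r : ℂ => Gamma a / r ^ a) {r : ℂ | 0 < r.re} :=
    DifferentiableOn.analyticOnNhd (fun r hr =>
      ((differentiableAt_const _).div (differentiableAt_id.cpow_const (hslit hr)) fun h =>
        slitPlane_ne_zero (hslit hr) ((cpow_eq_zero_iff r a).mp h).1).differentiableWithinAt) hopen
  have hreal (x : ℝ) (hx : 0 < x) :
      ∫ t : ℝ in Ioi 0, (t : ℂ) ^ (a - 1) * exp (-(x * t)) = Gamma a / (x : ℂ) ^ a := by
    rw [integral_cpow_mul_exp_neg_mul_Ioi ha hx, one_div, inv_cpow, mul_comm, ← div_eq_mul_inv]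
    rw [arg_ofReal_of_nonneg hx.le]
    exact Real.pi_ne_zero.symm
  have hto : Tendsto (fun n : ℕ => ((1 + 1 / ((n : ℝ) + 1) : ℝ) : ℂ)) atTop (𝓝[≠] 1) := by
    refine tendsto_nhdsWithin_iff.mpr ⟨?_, .of_forall fun n => ?_⟩
    · simpa using (tendsto_one_div_add_atTop_nhds_zero_nat (𝕜 := ℂ)).const_add 1
    · simpa using Nat.cast_add_one_ne_zero (R := ℂ) n
  exact hint.eqOn_of_preconnected_of_frequently_eq hpow
    (convex_halfSpace_re_gt 0).isPreconnected (by simp)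
    (hto.frequently (.of_forall fun n => hreal _ (by positivity))) hr

/-! ### Lipschitz's formula -/

/-- The function `y ^ (s - 1) e(y w)` on the positive reals, extended by zero (for `s ≠ 1`, through
`0 ^ (s - 1) = 0`); Lipschitz's formula is Poisson summation for it. -/
def halfLineFun (s w : ℂ) (y : ℝ) : ℂ := ((max y 0 : ℝ) : ℂ) ^ (s - 1) * e (y * w)

lemma halfLineFun_of_pos (s w : ℂ) {y : ℝ} (hy : 0 < y) :
    halfLineFun s w y = (y : ℂ) ^ (s - 1) * e (y * w) := by
  rw [halfLineFun, max_eq_left hy.le]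

lemma halfLineFun_of_nonpos {s : ℂ} (w : ℂ) (hs : s ≠ 1) {y : ℝ} (hy : y ≤ 0) :
    halfLineFun s w y = 0 := by
  rw [halfLineFun, max_eq_right hy, ofReal_zero, zero_cpow (sub_ne_zero.mpr hs), zero_mul]

lemma continuous_halfLineFun {s : ℂ} (w : ℂ) (hs : 1 < s.re) : Continuous (halfLineFun s w) := by
  have h : Continuous fun y : ℝ => ((max y 0 : ℝ) : ℂ) ^ (s - 1) :=
    (continuous_ofReal_cpow_const (by simpa using hs)).comp (continuous_id.max continuous_const)
  unfold halfLineFun e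
  fun_prop

lemma norm_halfLineFun_of_pos (s w : ℂ) {y : ℝ} (hy : 0 < y) :
    ‖halfLineFun s w y‖ = y ^ (s.re - 1) * Real.exp (-(2 * Real.pi * w.im) * y) := by
  rw [halfLineFun_of_pos s w hy, norm_mul, norm_cpow_eq_rpow_re_of_pos hy, norm_e_ofReal_mul,
    sub_re, one_re]
  ring_nf

lemma isBigO_halfLineFun {s w : ℂ} (hs : s ≠ 1) (hw : 0 < w.im) (b : ℝ) :
    halfLineFun s w =O[cocompact ℝ] fun x => |x| ^ b := by
  rw [cocompact_eq_atBot_atTop, isBigO_sup]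
  constructor
  · refine (isBigO_zero _ _).congr' ?_ .rfl
    filter_upwards [eventually_le_atBot 0] with y hy using (halfLineFun_of_nonpos w hs hy).symm
  · have hexp := (isLittleO_exp_neg_mul_rpow_atTop (a := 2 * Real.pi * w.im) (by positivity)
      (b - (s.re - 1))).isBigO
    refine (((isBigO_refl (fun y : ℝ => y ^ (s.re - 1)) atTop).mul hexp).congr' ?_ ?_).of_norm_left
    · filter_upwards [eventually_gt_atTop 0] with y hy using (norm_halfLineFun_of_pos s w hy).symm
    · filter_upwards [eventually_gt_atTop 0] with y hy
      rw [← Real.rpow_add hy, abs_of_pos hy, add_sub_cancel]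

open scoped FourierTransform

lemma fourier_halfLineFun {s w : ℂ} (hs : 1 < s.re) (hw : 0 < w.im) (x : ℝ) :
    𝓕 (halfLineFun s w) x =
      Gamma s / ((2 * Real.pi : ℂ) ^ s * exp (-Real.pi * I * s / 2) * (w - x) ^ s) := by
  have hwx : 0 < (w - x).im := by simpa using hw
  have hre : 0 < (-(2 * Real.pi * I * (w - x))).re := by simpa using by positivity
  rw [← neg_two_pi_I_mul_cpow hwx, ← integral_cpow_sub_one_mul_exp (by linarith) hre,
    Real.fourier_real_eq_integral_exp_smul, ← setIntegral_eq_integral_of_forall_compl_eq_zero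
      fun y (hy : y ∉ Ioi 0) => by
        rw [halfLineFun_of_nonpos w (ne_one_of_one_lt_re hs) (not_lt.mp hy), smul_zero]]
  refine setIntegral_congr_fun measurableSet_Ioi fun y hy => ?_
  simp only [halfLineFun_of_pos s w hy, smul_eq_mul, e]
  rw [mul_left_comm, ← Complex.exp_add]
  congr 2
  push_cast
  ring

lemma summable_inv_add_intCast_cpow {w s : ℂ} (hw : w.im ≠ 0) (hs : 1 < s.re) :
    Summable fun m : ℤ => ((w + m) ^ s)⁻¹ := by
  refine (((Real.summable_one_div_int_add_rpow w.re s.re).mpr hs).mul_right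
    (Real.exp (Real.pi * |s.im|))).of_norm_bounded_eventually ?_
  have hfin : {m : ℤ | (m : ℝ) + w.re = 0}.Finite :=
    Set.Subsingleton.finite fun a ha b hb => by
      exact_mod_cast add_right_cancel (ha.trans (Eq.symm hb))
  filter_upwards [hfin.compl_mem_cofinite] with m (hm : (m : ℝ) + w.re ≠ 0)
  have hne : w + m ≠ 0 := fun h => hw (by simpa using congrArg im h)
  have hle : |m + w.re| ≤ ‖w + m‖ := by simpa [add_comm] using abs_re_le_norm (w + m)
  rw [← powPlus_eq_cpow hne, one_div, ← Real.rpow_neg (abs_nonneg _)]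
  refine (norm_inv_powPlus_le s hne).trans (mul_le_mul_of_nonneg_right ?_ (Real.exp_nonneg _))
  exact Real.rpow_le_rpow_of_nonpos (abs_pos.mpr hm) hle (by linarith)

lemma tsum_halfLineFun_add_intCast (δ : ℝ) {s : ℂ} (w : ℂ) (hs : s ≠ 1) :
    ∑' n : ℤ, halfLineFun s w (δ + n) =
      ∑' l : {l : ℤ // -δ < l}, e ((δ + l) * w) / ((δ + l : ℝ) : ℂ) ^ (1 - s) := by
  have hsupp : Function.support (fun n : ℤ => halfLineFun s w (δ + n)) ⊆ {n : ℤ | -δ < n} :=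
    fun n hn => by
      by_contra h
      have hle : n ≤ -δ := not_lt.mp h
      exact hn (halfLineFun_of_nonpos w hs (by linarith))
  rw [← tsum_subtype_eq_of_support_subset hsupp]
  refine tsum_congr fun ⟨l, (hl : -δ < l)⟩ => ?_
  rw [halfLineFun_of_pos s w (by linarith), ← neg_sub s 1, cpow_neg, div_inv_eq_mul, mul_comm]
  push_cast
  rfl

lemma hasSum_lipschitz (δ : ℝ) {s w : ℂ} (hs : 1 < s.re) (hw : 0 < w.im) :
    HasSum (fun m : ℤ => e (-(m * δ)) / (w + m) ^ s)
      ((2 * Real.pi : ℂ) ^ s * (Gamma s)⁻¹ * exp (-Real.pi * I * s / 2) *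
        ∑' l : {l : ℤ // -δ < l}, e ((δ + l) * w) / ((δ + l : ℝ) : ℂ) ^ (1 - s)) := by
  set c : ℂ := (2 * Real.pi : ℂ) ^ s * exp (-Real.pi * I * s / 2) with hc
  have hΓ : Gamma s ≠ 0 := Gamma_ne_zero_of_re_pos (by linarith)
  have hc0 : c ≠ 0 := mul_ne_zero ((cpow_ne_zero_iff_of_exponent_ne_zero
    (ne_zero_of_one_lt_re hs)).mpr (by simp [Real.pi_ne_zero])) (exp_ne_zero _)
  have hcoeff (m : ℤ) :
      𝓕 (halfLineFun s w) ((-m : ℤ) : ℝ) = Gamma s / c * ((w + m) ^ s)⁻¹ := by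
    rw [fourier_halfLineFun hs hw, ← hc, ← div_div, Int.cast_neg, ofReal_neg, sub_neg_eq_add,
      ofReal_intCast, div_eq_mul_inv (Gamma s / c)]
  have hsum : Summable fun n : ℤ => 𝓕 (halfLineFun s w) (n : ℝ) := by
    rw [← (Equiv.neg ℤ).summable_iff]
    exact ((summable_inv_add_intCast_cpow hw.ne' hs).mul_left _).congr fun m => (hcoeff m).symm
  have hsum' : Summable fun n : ℤ => 𝓕 (halfLineFun s w) (n : ℝ) * fourier n (δ : UnitAddCircle) :=
    .of_norm <| hsum.norm.congr fun n => by rw [norm_mul, fourier_apply, Circle.norm_coe, mul_one]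
  have hpoisson := Real.tsum_eq_tsum_fourier_of_rpow_decay_of_summable
    (continuous_halfLineFun w hs) one_lt_two
    (isBigO_halfLineFun (ne_one_of_one_lt_re hs) hw _) hsum δ
  rw [tsum_halfLineFun_add_intCast δ w (ne_one_of_one_lt_re hs)] at hpoisson
  rw [hpoisson, mul_right_comm (_ ^ s), ← hc]
  refine (((Equiv.neg ℤ).hasSum_iff.mpr hsum'.hasSum).mul_left _).congr_fun fun m => ?_
  have hfourier : fourier (-m) (δ : UnitAddCircle) = e (-(m * δ)) := by
    rw [fourier_coe_apply, e]
    push_cast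
    ring_nf
  rw [Function.comp_apply, Equiv.neg_apply, hcoeff, hfourier]
  field_simp

/-! ### The `q`-series -/

lemma fracPrime_eq (γ : ℝ) : fracPrime γ = γ + ⌊-γ⌋ + 1 := by
  rw [fracPrime, Int.fract]
  ring

lemma fracPrime_pos (γ : ℝ) : 0 < fracPrime γ := by
  rw [fracPrime_eq]
  linarith [Int.lt_floor_add_one (-γ)]

/-- The increasing enumeration of the integers `k > -γ`, the summation ranges of the `q`-series; the
first of the numbers `γ + k` is `fracPrime γ`. -/
def natEquivGt (γ : ℝ) : ℕ ≃ {k : ℤ // -γ < k} where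
  toFun j := ⟨⌊-γ⌋ + 1 + j, Int.floor_lt.mp (by lia)⟩
  invFun k := (k - ⌊-γ⌋ - 1).toNat
  left_inv j := by
    simp only
    lia
  right_inv k := by
    have := Int.floor_lt.mpr k.2
    ext
    simp only
    lia

lemma coe_natEquivGt (γ : ℝ) (j : ℕ) : (natEquivGt γ j : ℤ) = ⌊-γ⌋ + 1 + j := rfl

lemma add_natEquivGt (γ : ℝ) (j : ℕ) : γ + (natEquivGt γ j : ℤ) = fracPrime γ + j := by
  rw [fracPrime_eq, coe_natEquivGt]
  push_cast
  ring

lemma norm_qTerm (r : ℂ) (γ δ κ lam : ℝ) (z : ℂ) (k : ℤ) {l : ℤ} (hl : -δ < l) :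
    ‖qTerm r γ δ κ lam z k l‖ =
      (δ + l) ^ (-r.re) * Real.exp (-(2 * Real.pi * ((γ + k) * (δ + l)) * z.im)) := by
  have hl' : 0 < δ + l := by linarith
  have hnum : ‖e ((γ + k) * κ + (δ + l) * lam)‖ = 1 := by
    exact_mod_cast norm_e_ofReal ((γ + k) * κ + (δ + l) * lam)
  have hq : ‖e ((γ + k) * (δ + l) * z)‖ =
      Real.exp (-(2 * Real.pi * ((γ + k) * (δ + l)) * z.im)) := by
    exact_mod_cast norm_e_ofReal_mul ((γ + k) * (δ + l)) z
  rw [qTerm, norm_mul, norm_div, norm_cpow_eq_rpow_re_of_pos hl', hnum, hq, Real.rpow_neg hl'.le,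
    one_div]

lemma summable_rpow_mul_exp_neg {b : ℝ} (hb : 0 < b) (d p : ℝ) :
    Summable fun j : ℕ => (d + j) ^ p * Real.exp (-(b * (d + j))) := by
  have hto : Tendsto (fun j : ℕ => d + (j : ℝ)) atTop atTop :=
    tendsto_atTop_add_const_left _ _ tendsto_natCast_atTop_atTop
  have hO := ((isLittleO_rpow_exp_pos_mul_atTop p (half_pos hb)).isBigO.comp_tendsto hto).mul
    (isBigO_refl (fun j : ℕ => Real.exp (-(b * (d + j)))) atTop)
  have hgeom : Summable fun j : ℕ => Real.exp (-(b / 2 * d)) * Real.exp (-(b / 2)) ^ j :=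
    (summable_geometric_of_lt_one (Real.exp_nonneg _)
      (Real.exp_lt_one_iff.mpr (by linarith))).mul_left _
  refine summable_of_isBigO_nat (hgeom.congr fun j => ?_) hO
  rw [← Real.exp_nat_mul, Function.comp_apply, ← Real.exp_add, ← Real.exp_add]
  ring_nf

section

variable (r : ℂ) (γ δ κ lam : ℝ) {z : ℂ}

-- With `c = ⟨γ⟩'` and `d = ⟨δ⟩'`, the exponent satisfies `(c + i) (d + j) ≥ i d + c (d + j)`.
lemma summable_norm_qTerm (hz : 0 < z.im) :
    Summable fun p : QIndex γ δ => ‖qTerm r γ δ κ lam z p.1 p.2‖ := by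
  rw [← ((natEquivGt γ).prodCongr (natEquivGt δ)).summable_iff]
  have hγ := fracPrime_pos γ
  have hδ := fracPrime_pos δ
  have hi : Summable fun i : ℕ => Real.exp (-(2 * Real.pi * z.im * fracPrime δ)) ^ i :=
    summable_geometric_of_lt_one (Real.exp_nonneg _)
      (Real.exp_lt_one_iff.mpr (neg_lt_zero.mpr (by positivity)))
  have hj := summable_rpow_mul_exp_neg (b := 2 * Real.pi * z.im * fracPrime γ) (by positivity)
    (fracPrime δ) (-r.re)
  refine (hi.mul_of_nonneg hj (fun i => by positivity) fun j => by positivity).of_nonneg_of_le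
    (fun _ => norm_nonneg _) fun ⟨i, j⟩ => ?_
  simp only [Function.comp_apply, Equiv.prodCongr_apply, Prod.map_apply]
  rw [norm_qTerm _ _ _ _ _ _ _ (natEquivGt δ j).2, add_natEquivGt, add_natEquivGt,
    mul_left_comm (Real.exp _ ^ i), ← Real.exp_nat_mul, ← Real.exp_add]
  gcongr
  have : 0 ≤ 2 * Real.pi * z.im * (i * j) := by positivity
  linarith

lemma rpow_le_rpow_add_rpow {x p q R : ℝ} (hx : 0 < x) (hq : q ≤ p) (hR : p ≤ R) :
    x ^ p ≤ x ^ q + x ^ R := by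
  rcases le_total 1 x with h | h
  · exact (Real.rpow_le_rpow_of_exponent_le h hR).trans (le_add_of_nonneg_left (by positivity))
  · exact (Real.rpow_le_rpow_of_exponent_ge hx h hq).trans
      (le_add_of_nonneg_right (by positivity))

lemma norm_qTerm_le_add (z : ℂ) {r : ℂ} {a b : ℝ} (ha : a ≤ r.re) (hb : r.re ≤ b) (k : ℤ) {l : ℤ}
    (hl : -δ < l) : ‖qTerm r γ δ κ lam z k l‖ ≤
      ‖qTerm b γ δ κ lam z k l‖ + ‖qTerm a γ δ κ lam z k l‖ := by
  simp only [norm_qTerm _ _ _ _ _ _ _ hl, ← add_mul, ofReal_re]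
  gcongr
  exact rpow_le_rpow_add_rpow (by linarith) (neg_le_neg hb) (neg_le_neg ha)

lemma differentiable_qTerm (z : ℂ) (k : ℤ) {l : ℤ} (hl : -δ < l) :
    Differentiable ℂ fun r => qTerm r γ δ κ lam z k l := by
  have hl0 : ((δ + l : ℝ) : ℂ) ≠ 0 := ofReal_ne_zero.mpr (by linarith)
  have hpow : Differentiable ℂ fun r : ℂ => ((δ + l : ℝ) : ℂ) ^ r :=
    differentiable_id.const_cpow (.inl hl0)
  exact ((differentiable_const _).div hpow
    fun r h => hl0 ((cpow_eq_zero_iff _ r).mp h).1).mul_const _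

lemma differentiable_qSeries (hz : 0 < z.im) : Differentiable ℂ fun r => qSeries r γ δ κ lam z := by
  intro r
  have hU : IsOpen {w : ℂ | r.re - 1 < w.re ∧ w.re < r.re + 1} :=
    (isOpen_lt continuous_const continuous_re).inter (isOpen_lt continuous_re continuous_const)
  refine DifferentiableOn.differentiableAt ?_ (hU.mem_nhds ⟨by linarith, by linarith⟩)
  exact differentiableOn_tsum_of_summable_norm
    ((summable_norm_qTerm ((r.re + 1 : ℝ) : ℂ) γ δ κ lam hz).add
      (summable_norm_qTerm ((r.re - 1 : ℝ) : ℂ) γ δ κ lam hz))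
    (fun p => (differentiable_qTerm γ δ κ lam z p.1 p.2.2).differentiableOn) hU
    fun p w hw => norm_qTerm_le_add γ δ κ lam z hw.1.le hw.2.le p.1 p.2.2

lemma norm_e_mul_e (κ x : ℝ) (z : ℂ) :
    ‖e κ * e (x * z)‖ = Real.exp (-(2 * Real.pi * x * z.im)) := by
  rw [norm_mul, norm_e_ofReal, norm_e_ofReal_mul, one_mul]

lemma hasSum_qTerm_fst (hz : 0 < z.im) {l : ℤ} (hl : -δ < l) :
    HasSum (fun k : {k : ℤ // -γ < k} => qTerm r γ δ κ lam z k l)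
      (qTermSum r γ δ κ lam z l) := by
  have hl' : 0 < δ + l := by linarith
  have hlt : ‖e κ * e ((δ + l) * z)‖ < 1 := by
    have hnorm := norm_e_mul_e κ (δ + l) z
    push_cast at hnorm
    rw [hnorm, Real.exp_lt_one_iff, neg_lt_zero]
    positivity
  rw [← (natEquivGt γ).hasSum_iff, qTermSum, ← div_div, div_eq_mul_inv _ (1 - _)]
  refine ((hasSum_geometric_of_norm_lt_one hlt).mul_left _).congr_fun fun j => ?_
  have hγ : (γ : ℂ) + ((natEquivGt γ j : ℤ) : ℂ) = fracPrime γ + j := by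
    exact_mod_cast congrArg ((↑) : ℝ → ℂ) (add_natEquivGt γ j)
  rw [Function.comp_apply, qTerm, hγ, mul_pow, ← e_nat_mul, ← e_nat_mul]
  simp only [add_mul, e_add]
  ring_nf

lemma hasSum_qTermSum (hz : 0 < z.im) :
    HasSum (fun l : {l : ℤ // -δ < l} => qTermSum r γ δ κ lam z l) (qSeries r γ δ κ lam z) :=
  hasSum_of_hasSum_prod_of_hasSum_fst
    (f := fun (k : {k : ℤ // -γ < k}) (l : {l : ℤ // -δ < l}) => qTerm r γ δ κ lam z k l)
    (summable_norm_qTerm r γ δ κ lam hz).of_norm.hasSum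
    fun l => hasSum_qTerm_fst r γ δ κ lam hz l.2

lemma hasSum_tsum_qTerm (hz : 0 < z.im) :
    HasSum (fun k : {k : ℤ // -γ < k} => ∑' l : {l : ℤ // -δ < l}, qTerm r γ δ κ lam z k l)
      (qSeries r γ δ κ lam z) :=
  have hsum := (summable_norm_qTerm r γ δ κ lam hz).of_norm
  hsum.hasSum.prod_fiberwise fun k => (hsum.prod_factor k).hasSum

end

/-! ### The asymptotic expansion of the `q`-series -/

lemma tendsto_re_atInftySector {θ : ℝ} (hθ : θ < Real.pi / 2) :
    Tendsto re (atInftySector θ) atTop := by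
  rcases lt_or_ge θ 0 with hθ₀ | hθ₀
  · have hempty : {τ : ℂ | |arg τ| ≤ θ} = ∅ :=
      eq_empty_of_forall_notMem fun τ hτ => (hθ₀.trans_le (abs_nonneg (arg τ))).not_ge hτ
    rw [atInftySector, hempty, principal_empty, inf_bot_eq]
    exact tendsto_bot
  · have hcos : Tendsto (fun τ : ℂ => ‖τ‖ * Real.cos θ) (atInftySector θ) atTop :=
      (tendsto_norm_cobounded_atTop.mono_left inf_le_left).atTop_mul_const
        (Real.cos_pos_of_mem_Ioo ⟨by linarith, hθ⟩)
    refine tendsto_atTop_mono' _ ?_ hcos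
    filter_upwards [mem_inf_of_right (mem_principal_self {τ : ℂ | |arg τ| ≤ θ})]
      with τ (hτ : |arg τ| ≤ θ)
    rw [← norm_mul_cos_arg τ, ← Real.cos_abs (arg τ)]
    gcongr
    exact Real.cos_le_cos_of_nonneg_of_le_pi (abs_nonneg _) (by linarith) hτ

lemma e_mul_I_mul (x τ : ℂ) : e (x * (I * τ)) = exp (-2 * Real.pi * x * τ) := by
  rw [e]
  congr 1
  linear_combination (2 * Real.pi * x * τ) * I_mul_I

lemma tendsto_e_mul_e_atInftySector (κ : ℝ) {x θ : ℝ} (hx : 0 < x) (hθ : θ < Real.pi / 2) :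
    Tendsto (fun τ : ℂ => e κ * e (x * (I * τ))) (atInftySector θ) (𝓝 0) := by
  rw [tendsto_zero_iff_norm_tendsto_zero]
  have h : Tendsto (fun τ : ℂ => 2 * Real.pi * x * τ.re) (atInftySector θ) atTop :=
    (tendsto_re_atInftySector hθ).const_mul_atTop (by positivity)
  refine (Real.tendsto_exp_neg_atTop_nhds_zero.comp h).congr fun τ => ?_
  rw [norm_e_mul_e, Function.comp_apply, I_mul_im]

section

variable (r : ℂ) (γ δ κ lam : ℝ)

lemma qTermSum_isTheta {θ : ℝ} (hθ : θ < Real.pi / 2) {l : ℤ} (hl : -δ < l) :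
    (fun τ : ℂ => qTermSum r γ δ κ lam (I * τ) l) =Θ[atInftySector θ]
      fun τ : ℂ => exp (-2 * Real.pi * fracPrime γ * (δ + l) * τ) := by
  have hl' : 0 < δ + l := by linarith
  have hlim : Tendsto (fun τ : ℂ => (1 - e κ * e ((δ + l : ℝ) * (I * τ)))⁻¹)
      (atInftySector θ) (𝓝 1) := by
    simpa only [sub_zero, inv_one] using
      ((tendsto_e_mul_e_atInftySector κ hl' hθ).const_sub 1).inv₀ (by norm_num)
  have hdenom := ((isEquivalent_const_iff_tendsto one_ne_zero).mpr hlim).isTheta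
  set c : ℂ := e (fracPrime γ * κ) * e ((δ + l) * lam) / ((δ + l : ℝ) : ℂ) ^ r with hc
  have hc0 : c ≠ 0 := div_ne_zero (mul_ne_zero (e_ne_zero _) (e_ne_zero _))
    fun h => ofReal_ne_zero.mpr hl'.ne' ((cpow_eq_zero_iff _ _).mp h).1
  have hmain := ((isTheta_refl (fun τ : ℂ => exp (-2 * Real.pi * fracPrime γ * (δ + l) * τ))
    (atInftySector θ)).mul hdenom).const_mul_left hc0
  refine (EventuallyEq.isTheta (.of_forall fun τ => ?_)).trans
    (hmain.trans_eventuallyEq (.of_forall fun τ => mul_one _))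
  simp only [qTermSum, hc]
  rw [e_mul_I_mul (fracPrime γ * (δ + l)), ← mul_assoc (-2 * Real.pi : ℂ), ← div_div,
    div_eq_mul_inv _ (1 - _), ofReal_add, ofReal_intCast]
  ring

lemma norm_qTermSum_le {z : ℂ} (hz : 0 < z.im) {l : ℤ} (hl : -δ < l) :
    ‖qTermSum r γ δ κ lam z l‖ ≤
      (δ + l) ^ (-r.re) * Real.exp (-(2 * Real.pi * (fracPrime γ * (δ + l)) * z.im)) *
        (1 - Real.exp (-(2 * Real.pi * (δ + l) * z.im)))⁻¹ := by
  have hl' : 0 < δ + l := by linarith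
  have hκ : ‖e (fracPrime γ * κ)‖ = 1 := by exact_mod_cast norm_e_ofReal (fracPrime γ * κ)
  have hlam : ‖e ((δ + l) * lam)‖ = 1 := by exact_mod_cast norm_e_ofReal ((δ + l) * lam)
  have hq : ‖e (fracPrime γ * (δ + l) * z)‖ =
      Real.exp (-(2 * Real.pi * (fracPrime γ * (δ + l)) * z.im)) := by
    exact_mod_cast norm_e_ofReal_mul (fracPrime γ * (δ + l)) z
  have hden : 1 - Real.exp (-(2 * Real.pi * (δ + l) * z.im)) ≤ ‖1 - e κ * e ((δ + l) * z)‖ := by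
    have h : ‖e κ * e ((δ + l) * z)‖ = Real.exp (-(2 * Real.pi * (δ + l) * z.im)) := by
      exact_mod_cast norm_e_mul_e κ (δ + l) z
    simpa only [norm_one, h] using norm_sub_norm_le 1 (e κ * e ((δ + l) * z))
  have hpos : 0 < 1 - Real.exp (-(2 * Real.pi * (δ + l) * z.im)) :=
    sub_pos.mpr (Real.exp_lt_one_iff.mpr (neg_lt_zero.mpr (by positivity)))
  rw [qTermSum, norm_div, norm_mul, norm_mul, norm_mul, hκ, hlam, hq,
    norm_cpow_eq_rpow_re_of_pos hl', one_mul, one_mul, div_eq_mul_inv, mul_inv, ← mul_assoc,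
    mul_comm (Real.exp _), Real.rpow_neg hl'.le]
  gcongr

lemma hasSum_qSeries_sub_qPartialSum {z : ℂ} (hz : 0 < z.im) {L : ℤ} (hL : ⌊-δ⌋ ≤ L) :
    HasSum (fun j : ℕ => qTermSum r γ δ κ lam z (L + 1 + j))
      (qSeries r γ δ κ lam z - qPartialSum r γ δ κ lam z L) := by
  have h := (natEquivGt δ).hasSum_iff.mpr (hasSum_qTermSum r γ δ κ lam hz)
  obtain ⟨n, rfl⟩ := Int.le.dest hL
  have hpartial : qPartialSum r γ δ κ lam z (⌊-δ⌋ + n) =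
      ∑ j ∈ Finset.range n, qTermSum r γ δ κ lam z (natEquivGt δ j) := by
    simp only [qPartialSum, Int.Ioc_eq_finset_map, Finset.sum_map, add_sub_cancel_left,
      Int.toNat_natCast, coe_natEquivGt]
    refine Finset.sum_congr rfl fun j _ => congrArg _ ?_
    simp [add_comm]
  rw [hpartial]
  refine ((hasSum_nat_add_iff' n).mpr h).congr_fun fun j => ?_
  rw [Function.comp_apply, coe_natEquivGt]
  congr 1
  push_cast
  ring

lemma norm_qTermSum_le_of_le {z : ℂ} (hz : 1 ≤ z.im) {D : ℝ} (hD : 0 < D) {l : ℤ}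
    (hl : D ≤ δ + l) :
    ‖qTermSum r γ δ κ lam z l‖ ≤
      (δ + l) ^ (-r.re) * (Real.exp (2 * Real.pi * fracPrime γ * D) *
        Real.exp (-(2 * Real.pi * fracPrime γ * (δ + l))) *
          Real.exp (-(2 * Real.pi * fracPrime γ * D * z.im))) *
        (1 - Real.exp (-(2 * Real.pi * D)))⁻¹ := by
  have hγ := fracPrime_pos γ
  have hl' : 0 < δ + l := hD.trans_le hl
  have hexp : Real.exp (-(2 * Real.pi * (fracPrime γ * (δ + l)) * z.im)) ≤
      Real.exp (2 * Real.pi * fracPrime γ * D) *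
        Real.exp (-(2 * Real.pi * fracPrime γ * (δ + l))) *
          Real.exp (-(2 * Real.pi * fracPrime γ * D * z.im)) := by
    rw [← Real.exp_add, ← Real.exp_add, Real.exp_le_exp]
    have : 0 ≤ 2 * Real.pi * fracPrime γ * ((δ + l - D) * (z.im - 1)) :=
      mul_nonneg (by positivity) (mul_nonneg (sub_nonneg.mpr hl) (sub_nonneg.mpr hz))
    linarith
  have hinv : (1 - Real.exp (-(2 * Real.pi * (δ + l) * z.im)))⁻¹ ≤
      (1 - Real.exp (-(2 * Real.pi * D)))⁻¹ := by
    have hle : D ≤ (δ + l) * z.im := hl.trans (le_mul_of_one_le_right hl'.le hz)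
    have hpos : 0 < 1 - Real.exp (-(2 * Real.pi * D)) :=
      sub_pos.mpr (Real.exp_lt_one_iff.mpr (neg_lt_zero.mpr (by positivity)))
    rw [mul_assoc]
    exact inv_anti₀ hpos (by gcongr)
  have hz0 : 0 < z.im := by linarith
  have hinv0 : 0 ≤ (1 - Real.exp (-(2 * Real.pi * (δ + l) * z.im)))⁻¹ :=
    inv_nonneg.mpr (sub_nonneg.mpr (Real.exp_le_one_iff.mpr (neg_nonpos.mpr (by positivity))))
  refine (norm_qTermSum_le r γ δ κ lam hz0 (by linarith)).trans ?_
  gcongr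

lemma exists_norm_qSeries_sub_qPartialSum_le {L : ℤ} (hL : ⌊-δ⌋ ≤ L) :
    ∃ C : ℝ, ∀ z : ℂ, 1 ≤ z.im → ‖qSeries r γ δ κ lam z - qPartialSum r γ δ κ lam z L‖ ≤
      C * Real.exp (-(2 * Real.pi * fracPrime γ * (δ + (L + 1)) * z.im)) := by
  have hb : 0 < 2 * Real.pi * fracPrime γ := mul_pos Real.two_pi_pos (fracPrime_pos γ)
  have hD : 0 < δ + (L + 1) := by
    have : (⌊-δ⌋ : ℝ) ≤ L := by exact_mod_cast hL
    linarith [Int.lt_floor_add_one (-δ)]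
  obtain ⟨S, hsum⟩ := (summable_rpow_mul_exp_neg hb (δ + (L + 1)) (-r.re)).mul_left
    (Real.exp (2 * Real.pi * fracPrime γ * (δ + (L + 1))) *
      (1 - Real.exp (-(2 * Real.pi * (δ + (L + 1)))))⁻¹)
  refine ⟨S, fun z hz => ?_⟩
  rw [← (hasSum_qSeries_sub_qPartialSum r γ δ κ lam (by linarith) hL).tsum_eq]
  refine tsum_of_norm_bounded (hsum.mul_right _) fun j => ?_
  have hlj : δ + ((L + 1 + j : ℤ) : ℝ) = δ + (L + 1) + j := by
    push_cast
    ring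
  have hle := norm_qTermSum_le_of_le r γ δ κ lam hz hD (l := L + 1 + j)
    (hlj ▸ le_add_of_nonneg_right j.cast_nonneg)
  rw [hlj] at hle
  exact hle.trans_eq (by ring)

lemma qSeries_sub_qPartialSum_isBigO {θ : ℝ} (hθ : θ < Real.pi / 2) {L : ℤ} (hL : ⌊-δ⌋ ≤ L) :
    (fun τ : ℂ => qSeries r γ δ κ lam (I * τ) - qPartialSum r γ δ κ lam (I * τ) L)
      =O[atInftySector θ]
      fun τ : ℂ => Real.exp (-(2 * Real.pi * fracPrime γ * (δ + (L + 1)) * τ.re)) := by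
  obtain ⟨C, hC⟩ := exists_norm_qSeries_sub_qPartialSum_le r γ δ κ lam hL
  refine IsBigO.of_bound C ?_
  filter_upwards [(tendsto_re_atInftySector hθ).eventually_ge_atTop 1] with τ hτ
  rw [Real.norm_of_nonneg (Real.exp_nonneg _), ← I_mul_im]
  exact hC (I * τ) (by rwa [I_mul_im])

lemma isAsymptoticQSeries : IsAsymptoticQSeries r γ δ κ lam where
  hasSum _ hz := hasSum_qTermSum r γ δ κ lam hz
  order _ hθ _ hl := qTermSum_isTheta r γ δ κ lam hθ hl
  remainder θ hθ L hL := by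
    refine isBigO_norm_right.mp ((qSeries_sub_qPartialSum_isBigO r γ δ κ lam hθ hL).congr_right
      fun τ => ?_)
    have h := norm_e_ofReal_mul (fracPrime γ * (δ + (L + 1))) (I * τ)
    push_cast at h
    rw [e_mul_I_mul, I_mul_im, ← mul_assoc, ← mul_assoc] at h
    rw [h]

end

/-! ### The Eisenstein series -/

lemma latticePt_eq (α β : ℝ) (z : ℂ) (p : ℤ × ℤ) :
    latticePt α β z p = ((α + p.1 : ℝ) : ℂ) + ((β + p.2 : ℝ) : ℂ) * z := by
  rw [latticePt]
  push_cast
  rfl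

lemma latticePt_im (α β : ℝ) (z : ℂ) (p : ℤ × ℤ) :
    (latticePt α β z p).im = (β + p.2) * z.im := by
  rw [latticePt_eq, add_im, ofReal_im, im_ofReal_mul, zero_add]

lemma latticePt_neg (α β : ℝ) (z : ℂ) (p : ℤ × ℤ) :
    latticePt (-α) (-β) z (-p) = -latticePt α β z p := by
  simp only [latticePt, Prod.fst_neg, Prod.snd_neg]
  push_cast
  ring

lemma half_r_mul_norm_le_norm_latticePt (α β : ℝ) (z : UpperHalfPlane) {x : Fin 2 → ℤ}
    (hx0 : x ≠ 0) (hx : ‖(α + β * z : ℂ)‖ ≤ EisensteinSeries.r z / 2 * ‖x‖) :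
    EisensteinSeries.r z / 2 * ‖x‖ ≤ ‖latticePt α β z (x 1, x 0)‖ := by
  have hr : EisensteinSeries.r z * ‖x‖ ≤ ‖(x 0 * z + x 1 : ℂ)‖ :=
    EisensteinSeries.r_mul_max_le z hx0
  have hpt : latticePt α β z (x 1, x 0) = x 0 * z + x 1 - -(α + β * z) := by
    rw [latticePt]
    ring
  have htri := norm_sub_norm_le (x 0 * z + x 1 : ℂ) (-(α + β * z))
  rw [norm_neg, ← hpt] at htri
  linarith

lemma summable_norm_latticePt_rpow (α β : ℝ) {z : ℂ} (hz : 0 < z.im) {σ : ℝ} (hσ : 2 < σ) :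
    Summable fun p : ℤ × ℤ => ‖latticePt α β z p‖ ^ (-σ) := by
  rw [← ((finTwoArrowEquiv ℤ).trans (Equiv.prodComm ℤ ℤ)).summable_iff]
  set r := EisensteinSeries.r ⟨z, hz⟩
  have hr0 : 0 < r := EisensteinSeries.r_pos _
  refine ((EisensteinSeries.summable_one_div_norm_rpow hσ).mul_left
    ((r / 2) ^ (-σ))).of_norm_bounded_eventually ?_
  have hnorm : Tendsto (fun x : Fin 2 → ℤ => ‖x‖) cofinite atTop :=
    tendsto_norm_comp_cofinite_atTop_of_isClosedEmbedding
      (Topology.IsClosedEmbedding.id (X := Fin 2 → ℤ))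
  filter_upwards [hnorm.eventually_gt_atTop 0,
    hnorm.eventually_ge_atTop (‖(α + β * z : ℂ)‖ / (r / 2))] with x hx0 hx
  rw [div_le_iff₀' (by positivity)] at hx
  have hle := half_r_mul_norm_le_norm_latticePt α β ⟨z, hz⟩ (norm_pos_iff.mp hx0) hx
  change ‖‖latticePt α β z (x 1, x 0)‖ ^ (-σ)‖ ≤ _
  rw [Real.norm_of_nonneg (by positivity), ← Real.mul_rpow (by positivity) (by positivity)]
  exact Real.rpow_le_rpow_of_nonpos (by positivity) hle (by linarith)

lemma norm_eisTerm (pow : ℂ → ℂ → ℂ) (s : ℂ) (α β μ ν : ℝ) (z : ℂ) (p : ℤ × ℤ) :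
    ‖eisTerm pow s α β μ ν z p‖ = ‖(pow (latticePt α β z p) s)⁻¹‖ := by
  have : ‖e ((α + p.1) * μ + (β + p.2) * ν)‖ = 1 := by
    exact_mod_cast norm_e_ofReal ((α + p.1) * μ + (β + p.2) * ν)
  rw [eisTerm, norm_div, norm_inv, this, one_div]

lemma summable_norm_eisTerm {pow : ℂ → ℂ → ℂ} {s : ℂ} {C : ℝ}
    (hpow : ∀ u ≠ 0, ‖(pow u s)⁻¹‖ ≤ ‖u‖ ^ (-s.re) * C) (α β μ ν : ℝ) {z : ℂ}
    (hs : 2 < s.re) (hz : 0 < z.im) :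
    Summable fun p : {p : ℤ × ℤ // latticePt α β z p ≠ 0} => ‖eisTerm pow s α β μ ν z p‖ := by
  refine (((summable_norm_latticePt_rpow α β hz hs).mul_right C).comp_injective
    Subtype.val_injective).of_nonneg_of_le (fun _ => norm_nonneg _) fun p => ?_
  rw [norm_eisTerm]
  exact hpow _ p.2

/-- The mean of the summands of the Eisenstein series for the two branches, extended by zero to
the omitted index, so that it can be summed over all of `ℤ × ℤ`. -/
def meanTerm (s : ℂ) (α β μ ν : ℝ) (z : ℂ) : ℤ × ℤ → ℂ :=
  {p : ℤ × ℤ | latticePt α β z p ≠ 0}.indicator fun p =>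
    (eisTerm powPlus s α β μ ν z p + eisTerm powMinus s α β μ ν z p) / 2

section

variable (α β μ ν : ℝ) {s z : ℂ}

lemma hasSum_meanTerm (hs : 2 < s.re) (hz : 0 < z.im) :
    HasSum (meanTerm s α β μ ν z) (eisF s α β μ ν z) := by
  have hplus := summable_norm_eisTerm (fun _ => norm_inv_powPlus_le s) α β μ ν hs hz
  have hminus := summable_norm_eisTerm (fun _ => norm_inv_powMinus_le s) α β μ ν hs hz
  exact hasSum_subtype_iff_indicator.mp
    ((hplus.of_norm.hasSum.add hminus.of_norm.hasSum).div_const 2)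

/-! ### Rows off the real axis -/

variable (s) in
lemma meanTerm_of_im_ne_zero {p : ℤ × ℤ} (hp : (latticePt α β z p).im ≠ 0) :
    meanTerm s α β μ ν z p = e ((α + p.1) * μ + (β + p.2) * ν) / latticePt α β z p ^ s := by
  have hne : latticePt α β z p ≠ 0 := fun h => hp (by rw [h, zero_im])
  have harg : arg (latticePt α β z p) ≠ Real.pi := fun h => hp (arg_eq_pi_iff.mp h).2
  rw [meanTerm, indicator_of_mem (by exact hne), eisTerm, eisTerm, powMinus_eq_powPlus harg,
    powPlus_eq_cpow hne, add_self_div_two]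

lemma hasSum_meanTerm_row_of_pos (hs : 1 < s.re) (hz : 0 < z.im) {n : ℤ} (hn : -β < n) :
    HasSum (fun m : ℤ => meanTerm s α β μ ν z (m, n))
      (e (α * μ) * ((2 * Real.pi : ℂ) ^ s * (Gamma s)⁻¹) * exp (-Real.pi * I * s / 2) *
        ∑' l : {l : ℤ // -(-μ) < l}, qTerm (1 - s) β (-μ) ν α z n l) := by
  have him (m : ℤ) : 0 < (latticePt α β z (m, n)).im := by
    rw [latticePt_im]
    exact mul_pos (by simpa using neg_lt_iff_pos_add'.mp hn) hz
  have hw : 0 < (α + (β + n) * z).im := by simpa [latticePt] using him 0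
  have h := (hasSum_lipschitz (-μ) hs hw).mul_left (e (α * μ) * e ((β + n) * ν))
  have hrow (l : {l : ℤ // -(-μ) < l}) : qTerm (1 - s) β (-μ) ν α z n l = e ((β + n) * ν) *
      (e (((-μ : ℝ) + l) * (α + (β + n) * z)) / ((-μ + l : ℝ) : ℂ) ^ (1 - s)) := by
    rw [qTerm, e_add, mul_add _ (α : ℂ), e_add, mul_left_comm _ _ z, mul_assoc]
    ring
  simp only [hrow, tsum_mul_left]
  convert! h using 1
  · ext m
    rw [meanTerm_of_im_ne_zero α β μ ν s (him m).ne', e_add, add_mul, e_add, latticePt,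
      add_right_comm, ofReal_neg, mul_neg, neg_neg]
    ring
  · ring

lemma neg_cpow_of_im_pos {w : ℂ} (hw : 0 < w.im) (s : ℂ) :
    (-w) ^ s = exp (-(Real.pi * I * s)) * w ^ s := by
  have hw0 : w ≠ 0 := fun h => hw.ne' (by rw [h, zero_im])
  rw [cpow_def_of_ne_zero (neg_ne_zero.mpr hw0), cpow_def_of_ne_zero hw0, ← Complex.exp_add, log,
    log, norm_neg, arg_neg_eq_arg_sub_pi_of_im_pos hw]
  push_cast
  ring_nf

lemma meanTerm_neg {p : ℤ × ℤ} (hp : 0 < (latticePt (-α) (-β) z p).im) :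
    meanTerm s α β μ ν z (-p) =
      exp (Real.pi * I * s) * meanTerm s (-α) (-β) (-μ) (-ν) z p := by
  have hpt : latticePt α β z (-p) = -latticePt (-α) (-β) z p := by
    rw [← latticePt_neg, neg_neg, neg_neg]
  have hne : (latticePt α β z (-p)).im ≠ 0 := by
    rw [hpt, neg_im]
    exact neg_ne_zero.mpr hp.ne'
  rw [meanTerm_of_im_ne_zero α β μ ν s hne, meanTerm_of_im_ne_zero _ _ _ _ s hp.ne', hpt,
    neg_cpow_of_im_pos hp, Complex.exp_neg, div_eq_mul_inv, mul_inv, inv_inv, mul_left_comm,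
    div_eq_mul_inv]
  simp only [Prod.fst_neg, Prod.snd_neg]
  push_cast
  ring_nf

lemma hasSum_meanTerm_row_of_neg (hs : 1 < s.re) (hz : 0 < z.im) {n : ℤ} (hn : -(-β) < n) :
    HasSum (fun m : ℤ => meanTerm s α β μ ν z (m, -n))
      (e (α * μ) * ((2 * Real.pi : ℂ) ^ s * (Gamma s)⁻¹) * exp (Real.pi * I * s / 2) *
        ∑' l : {l : ℤ // -μ < l}, qTerm (1 - s) (-β) μ (-ν) (-α) z n l) := by
  have him (m : ℤ) : 0 < (latticePt (-α) (-β) z (m, n)).im := by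
    rw [latticePt_im]
    exact mul_pos (by simpa using neg_lt_iff_pos_add'.mp hn) hz
  have hexp : exp (Real.pi * I * s / 2) =
      exp (Real.pi * I * s) * exp (-Real.pi * I * s / 2) := by
    rw [← Complex.exp_add]
    ring_nf
  have h := hasSum_meanTerm_row_of_pos (-α) (-β) (-μ) (-ν) hs hz hn
  rw [neg_neg μ, ofReal_neg, ofReal_neg, neg_mul_neg] at h
  rw [← (Equiv.neg ℤ).hasSum_iff]
  convert! h.mul_left (exp (Real.pi * I * s)) using 1
  · ext m
    exact meanTerm_neg α β μ ν (him m)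
  · rw [hexp]
    ring

/-! ### The row on the real axis -/

lemma powPlus_neg_ofReal {x : ℝ} (hx : 0 < x) (s : ℂ) :
    powPlus (-x) s = (x : ℂ) ^ s * exp (Real.pi * s * I) := by
  rw [powPlus, norm_neg, norm_real, Real.norm_of_nonneg hx.le, ← ofReal_neg,
    arg_ofReal_of_neg (neg_lt_zero.mpr hx), cpow_def_of_ne_zero (ofReal_ne_zero.mpr hx.ne'),
    ofReal_log hx.le, ← Complex.exp_add]
  ring_nf

lemma powMinus_neg_ofReal {x : ℝ} (hx : 0 < x) (s : ℂ) :
    powMinus (-x) s = (x : ℂ) ^ s * exp (-(Real.pi * s) * I) := by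
  rw [powMinus, argMinus, norm_neg, norm_real, Real.norm_of_nonneg hx.le, ← ofReal_neg,
    if_pos (arg_ofReal_of_neg (neg_lt_zero.mpr hx)),
    cpow_def_of_ne_zero (ofReal_ne_zero.mpr hx.ne'), ofReal_log hx.le, ← Complex.exp_add]
  push_cast
  ring_nf

variable {β}

lemma latticePt_of_add_eq_zero (z : ℂ) (m : ℤ) {n : ℤ} (hn : β + n = 0) :
    latticePt α β z (m, n) = ((α + m : ℝ) : ℂ) := by
  rw [latticePt_eq, hn, ofReal_zero, zero_mul, add_zero]

lemma eisTerm_of_add_eq_zero (pow : ℂ → ℂ → ℂ) (s z : ℂ) (m : ℤ) {n : ℤ} (hn : β + n = 0) :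
    eisTerm pow s α β μ ν z (m, n) = e ((α + m) * μ) / pow ((α + m : ℝ) : ℂ) s := by
  have hn' : (β + n : ℂ) = 0 := by exact_mod_cast congrArg ((↑) : ℝ → ℂ) hn
  rw [eisTerm, latticePt_of_add_eq_zero α z m hn, hn', zero_mul, add_zero]

lemma meanTerm_of_add_eq_zero (s z : ℂ) {m n : ℤ} (hn : β + n = 0) (hm : α + m = 0) :
    meanTerm s α β μ ν z (m, n) = 0 := by
  have hpt : latticePt α β z (m, n) = 0 := by
    rw [latticePt_of_add_eq_zero α z m hn, hm, ofReal_zero]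
  exact indicator_of_notMem (not_not.mpr hpt) _

lemma meanTerm_of_add_pos (s z : ℂ) {m n : ℤ} (hn : β + n = 0) (hm : -α < m) :
    meanTerm s α β μ ν z (m, n) = psiTerm s α μ m := by
  have hm' : 0 < α + m := by linarith
  have hne : ((α + m : ℝ) : ℂ) ≠ 0 := ofReal_ne_zero.mpr hm'.ne'
  have hmem : (m, n) ∈ {p : ℤ × ℤ | latticePt α β z p ≠ 0} := by
    rwa [mem_ofPred_eq, latticePt_of_add_eq_zero α z m hn]
  have harg : arg ((α + m : ℝ) : ℂ) ≠ Real.pi := by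
    rw [arg_ofReal_of_nonneg hm'.le]
    exact Real.pi_ne_zero.symm
  rw [meanTerm, indicator_of_mem hmem, eisTerm_of_add_eq_zero α μ ν _ _ _ _ hn,
    eisTerm_of_add_eq_zero α μ ν _ _ _ _ hn, powMinus_eq_powPlus harg, powPlus_eq_cpow hne,
    add_self_div_two, psiTerm]

-- The two branches at a negative number differ from `|x| ^ s` by the factors `exp (±πis)`.
lemma meanTerm_neg_of_add_pos (s z : ℂ) {m n : ℤ} (hn : β + n = 0) (hm : -(-α) < m) :
    meanTerm s α β μ ν z (-m, n) = cos (Real.pi * s) * psiTerm s (-α) (-μ) m := by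
  have hm' : 0 < -α + m := by linarith
  have hpt : ((α + (-m : ℤ) : ℝ) : ℂ) = -((-α + m : ℝ) : ℂ) := by
    push_cast
    ring
  have hmem : (-m, n) ∈ {p : ℤ × ℤ | latticePt α β z p ≠ 0} := by
    rw [mem_ofPred_eq, latticePt_of_add_eq_zero α z _ hn, hpt]
    exact neg_ne_zero.mpr (ofReal_ne_zero.mpr hm'.ne')
  have he : ((α + (-m : ℤ)) * μ : ℂ) = ((-α : ℝ) + m) * (-μ : ℝ) := by
    push_cast
    ring
  rw [meanTerm, indicator_of_mem hmem, eisTerm_of_add_eq_zero α μ ν _ _ _ _ hn,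
    eisTerm_of_add_eq_zero α μ ν _ _ _ _ hn, hpt, powPlus_neg_ofReal hm', powMinus_neg_ofReal hm',
    he, psiTerm, cos, neg_mul, Complex.exp_neg]
  field_simp
  ring

variable (z) in
lemma hasSum_meanTerm_row_of_add_eq_zero (hs : 1 < s.re) {n : ℤ} (hn : β + n = 0) :
    HasSum (fun m : ℤ => meanTerm s α β μ ν z (m, n)) (calA s α μ) := by
  have hpos := (isLerchPsi_lerchPsi α μ).hasSum s hs
  have hneg := ((isLerchPsi_lerchPsi (-α) (-μ)).hasSum s hs).mul_left (cos (Real.pi * s))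
  have h := hasSum_int_of_hasSum_of_hasSum_neg
    (fun m hm => meanTerm_of_add_eq_zero α μ ν s z hn hm)
    (hpos.congr_fun fun m => meanTerm_of_add_pos α μ ν s z hn m.2)
    (hneg.congr_fun fun m => meanTerm_neg_of_add_pos α μ ν s z hn m.2)
  rwa [mul_zero, zero_add, add_comm, ← calA₀, ← calA_of_ne_one α μ (ne_one_of_one_lt_re hs)] at h

end

/-! ### The transformation formula and the asymptotic expansion -/

/-- The continuation of the Eisenstein series `eisF` to the whole `s`-plane, given by the right-hand
side of the transformation formula. -/
def eisCont (α β μ ν : ℝ) (s z : ℂ) : ℂ :=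
  delta β * calA s α μ +
    e (α * μ) * ((2 * Real.pi : ℂ) ^ s * (Gamma s)⁻¹) *
      (exp (-Real.pi * I * s / 2) * qSeries (1 - s) β (-μ) ν α z +
        exp (Real.pi * I * s / 2) * qSeries (1 - s) (-β) μ (-ν) (-α) z)

section

variable (α β μ ν : ℝ)

lemma eisCont_eq_eisF {s z : ℂ} (hs : 2 < s.re) (hz : 0 < z.im) :
    eisCont α β μ ν s z = eisF s α β μ ν z := by
  have hs1 : 1 < s.re := by linarith
  have hsum := hasSum_meanTerm α β μ ν hs hz
  have hrows : HasSum (fun n : ℤ => ∑' m : ℤ, meanTerm s α β μ ν z (m, n)) (eisF s α β μ ν z) :=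
    hasSum_of_hasSum_prod_of_hasSum_fst (f := fun m n => meanTerm s α β μ ν z (m, n)) hsum
      fun n => (hsum.summable.comp_injective (Prod.mk_left_injective n)).hasSum
  set K := e (α * μ) * ((2 * Real.pi : ℂ) ^ s * (Gamma s)⁻¹)
  have hpos := (hasSum_tsum_qTerm (1 - s) β (-μ) ν α hz).mul_left
    (K * exp (-Real.pi * I * s / 2))
  have hneg := (hasSum_tsum_qTerm (1 - s) (-β) μ (-ν) (-α) hz).mul_left
    (K * exp (Real.pi * I * s / 2))
  have h := hasSum_int_of_hasSum_of_hasSum_neg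
    (fun n hn => (hasSum_meanTerm_row_of_add_eq_zero α μ ν z hs1 hn).tsum_eq)
    (hpos.congr_fun fun n => (hasSum_meanTerm_row_of_pos α β μ ν hs1 hz n.2).tsum_eq)
    (hneg.congr_fun fun n => (hasSum_meanTerm_row_of_neg α β μ ν hs1 hz n.2).tsum_eq)
  rw [← h.unique hrows, eisCont]
  ring

lemma differentiable_eisCont {z : ℂ} (hz : 0 < z.im) :
    Differentiable ℂ fun s => eisCont α β μ ν s z := by
  have hA := differentiable_calA α μ
  have hsub : Differentiable ℂ fun s : ℂ => 1 - s := by fun_prop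
  have hpos := (differentiable_qSeries β (-μ) ν α hz).comp hsub
  have hneg := (differentiable_qSeries (-β) μ (-ν) (-α) hz).comp hsub
  have hΓ := differentiable_one_div_Gamma
  have hpi := differentiable_two_pi_cpow
  simp only [Function.comp_def] at hpos hneg
  unfold eisCont
  fun_prop

lemma eisCont_sub_isBigO (s : ℂ) {θ : ℝ} (hθ : θ < Real.pi / 2) {L L' : ℤ}
    (hL : ⌊μ⌋ ≤ L) (hL' : ⌊-μ⌋ ≤ L') :
    (fun τ : ℂ => eisCont α β μ ν s (I * τ) - (delta β * calA s α μ +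
      e (α * μ) * ((2 * Real.pi : ℂ) ^ s * (Gamma s)⁻¹) *
        (exp (-Real.pi * I * s / 2) * qPartialSum (1 - s) β (-μ) ν α (I * τ) L +
          exp (Real.pi * I * s / 2) * qPartialSum (1 - s) (-β) μ (-ν) (-α) (I * τ) L')))
      =O[atInftySector θ]
      fun τ : ℂ => Real.exp (-2 * Real.pi * fracPrime β * (-μ + (L + 1)) * τ.re) +
        Real.exp (-2 * Real.pi * fracPrime (-β) * (μ + (L' + 1)) * τ.re) := by
  set K := e (α * μ) * ((2 * Real.pi : ℂ) ^ s * (Gamma s)⁻¹) with hK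
  have hpos := (qSeries_sub_qPartialSum_isBigO (1 - s) β (-μ) ν α hθ
    (L := L) (by rwa [neg_neg])).const_mul_left (K * exp (-Real.pi * I * s / 2))
  have hneg := (qSeries_sub_qPartialSum_isBigO (1 - s) (-β) μ (-ν) (-α) hθ
    hL').const_mul_left (K * exp (Real.pi * I * s / 2))
  refine (hpos.add_add hneg).congr (fun τ => ?_) fun τ => ?_
  · rw [eisCont, ← hK]
    ring
  · simp only [Real.norm_of_nonneg (Real.exp_nonneg _), neg_mul]

end

end

end HolEis

theorem theorem1 (α β μ ν : ℝ) :
    -- the Lerch zeta-functions have their continuations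
    (∀ γ κ : ℝ, IsLerchPsi γ κ fun r => lerchPsi r γ κ) ∧
    -- `𝓐` is entire and has the two expressions
    (Differentiable ℂ fun s => calA s α μ) ∧
    (∀ s : ℂ, s ≠ 1 ∨ ¬ IsInt μ →
      calA s α μ = cos (Real.pi * s) * lerchPsi s (-α) (-μ) + lerchPsi s α μ) ∧
    (∀ s : ℂ, s ≠ 0 ∨ ¬ IsInt α →
      calA s α μ = e (α * μ) * ((2 * Real.pi : ℂ) ^ s * (2 * Gamma s)⁻¹) *
        (exp (-Real.pi * I * s / 2) * lerchPsi (1 - s) (-μ) α +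
          exp (Real.pi * I * s / 2) * lerchPsi (1 - s) μ (-α))) ∧
    -- the defining series converge absolutely for `Re s > 2`
    (∀ s z : ℂ, 2 < s.re → 0 < z.im →
      Summable (fun p : {p : ℤ × ℤ // latticePt α β z p ≠ 0} =>
        ‖eisTerm powPlus s α β μ ν z p‖) ∧
      Summable (fun p : {p : ℤ × ℤ // latticePt α β z p ≠ 0} =>
        ‖eisTerm powMinus s α β μ ν z p‖)) ∧
    -- the `q`-series converge absolutely for all `s`
    (∀ s z : ℂ, 0 < z.im →
      Summable (fun p : QIndex β (-μ) => ‖qTerm (1 - s) β (-μ) ν α z p.1 p.2‖) ∧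
      Summable (fun p : QIndex (-β) μ => ‖qTerm (1 - s) (-β) μ (-ν) (-α) z p.1 p.2‖)) ∧
    -- they are convergent asymptotic series as `τ → ∞`
    (∀ s : ℂ, IsAsymptoticQSeries (1 - s) β (-μ) ν α ∧
      IsAsymptoticQSeries (1 - s) (-β) μ (-ν) (-α)) ∧
    -- the transformation formula, the continuation `F` and its asymptotic series
    ∃ F : ℂ → ℂ → ℂ,
      (∀ z : ℂ, 0 < z.im → Differentiable ℂ fun s => F s z) ∧
      (∀ s z : ℂ, 2 < s.re → 0 < z.im → F s z = eisF s α β μ ν z) ∧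
      (∀ s z : ℂ, 0 < z.im →
        F s z = delta β * calA s α μ +
          e (α * μ) * ((2 * Real.pi : ℂ) ^ s * (Gamma s)⁻¹) *
            (exp (-Real.pi * I * s / 2) * qSeries (1 - s) β (-μ) ν α z +
              exp (Real.pi * I * s / 2) * qSeries (1 - s) (-β) μ (-ν) (-α) z)) ∧
      (∀ s : ℂ, ∀ θ < Real.pi / 2, ∀ L L' : ℤ, ⌊μ⌋ ≤ L → ⌊-μ⌋ ≤ L' →
        (fun τ : ℂ => F s (I * τ) - (delta β * calA s α μ +
          e (α * μ) * ((2 * Real.pi : ℂ) ^ s * (Gamma s)⁻¹) *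
            (exp (-Real.pi * I * s / 2) * qPartialSum (1 - s) β (-μ) ν α (I * τ) L +
              exp (Real.pi * I * s / 2) * qPartialSum (1 - s) (-β) μ (-ν) (-α) (I * τ) L')))
          =O[atInftySector θ]
          fun τ : ℂ => Real.exp (-2 * Real.pi * fracPrime β * (-μ + (L + 1)) * τ.re) +
            Real.exp (-2 * Real.pi * fracPrime (-β) * (μ + (L' + 1)) * τ.re)) := by
  refine ⟨isLerchPsi_lerchPsi, differentiable_calA α μ, fun s hs => calA_eq_calA₀ α μ hs,
    fun s hs => calA_eq_calADual α μ hs,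
    fun s z hs hz => ⟨summable_norm_eisTerm (fun _ => norm_inv_powPlus_le s) α β μ ν hs hz,
      summable_norm_eisTerm (fun _ => norm_inv_powMinus_le s) α β μ ν hs hz⟩,
    fun s z hz => ⟨summable_norm_qTerm _ _ _ _ _ hz, summable_norm_qTerm _ _ _ _ _ hz⟩,
    fun s => ⟨isAsymptoticQSeries _ _ _ _ _, isAsymptoticQSeries _ _ _ _ _⟩,
    eisCont α β μ ν, fun z hz => differentiable_eisCont α β μ ν hz,
    fun s z hs hz => eisCont_eq_eisF α β μ ν hs hz, fun s z _ => rfl,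
    fun s θ hθ L L' hL hL' => eisCont_sub_isBigO α β μ ν s hθ hL hL'⟩
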